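/- Let $n\ge 1$, let $\mathbb{D}^n=\{z\in\mathbb{C}^n: |z_1|<1,\dots,|z_n|<1\}$ be the unit polydisk, and let $F^{(1)},\dots,F^{(m)}:\mathbb{C}^n\to\mathbb{C}^n$ be polynomial vector fields. Consider the switched system $\dot z=F^{(\sigma)}(z)$, where the commutation law $\sigma:[0,\infty)\to\{1,\dots,m\}$ is any piecewise constant function with finitely many discontinuities on every bounded interval. *Assumptions.* 1. The origin is a common hyperbolic stable equilibrium: for all $i$, $F^{(i)}(0)=0$ and all eigenvalues of the Jacobian matrix $JF^{(i)}(0)$ have negative real part; and for each $i$ the origin is globally asymptotically stable on $\mathbb{D}^n$ for $\dot z=F^{(i)}(z)$. 2. The complex Lie algebra of matrices generated by $JF^{(1)}(0),\dots,JF^{(m)}(0)$ is solvable. 3. $\mathbb{D}^n$ is forward invariant for the flow of each $F^{(i)}$. *Notation.* Let $(\alpha(k))_{k\ge 0}$ enumerate $\mathbb{N}^n$ so that $\alpha(k)$ precedes $\alpha(j)$ if $|\alpha(k)|<|\alpha(j)|$, or if $|\alpha(k)|=|\alpha(j)|$ and $\alpha_l(k)>\alpha_l(j)$ for the smallest $l$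 with $\alpha_l(k)\ne\alpha_l(j)$; put $e_k(z)=z^{\alpha(k)}$. Let $\langle f,g\rangle=\int_{(\partial\mathbb{D})^n} f\,\bar g\,dm_n$ be the inner product of the Hardy space $\mathbb{H}^2(\mathbb{D}^n)$ ($m_n$ is the normalized Lebesgue measure on $(\partial\mathbb{D})^n$), and for a polynomial vector field $G$ let $L_G f=G\cdot\nabla f$ be its Koopman generator. For an invertible matrix $P$ put $\widehat F^{(i)}(\widehat z)=P^{-1}F^{(i)}(P\widehat z)$, and let $\widehat K^{(i)}$ be the number of pairs $(l,\beta)$, $1\le l\le n$, $\beta\in\mathbb{N}^n$, such that $\widehat z^{\,\beta}\neq \widehat z_l$ and the coefficient of $\widehat z^{\,\beta}$ in the component $\widehat F^{(i)}_l$ is nonzero. *Conclusion.* There is an invertible matrix $P$ with $\|P^{-1}\|_\infty=1$ (the matrix norm induced by the supremum norm) such that all matrices $P^{-1}JF^{(i)}(0)P$, $i=1,\dots,m$, are upper triangular. Moreover, for every such $P$: if $$\max_{i=1,\dots,m}\ \limsup_{j\to\infty}\ \max_{1\le k\le j-1}\ \frac{(\widehat K^{(i)})^2\,\bigl|\langle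 L_{\widehat F^{(i)}}e_k,e_j\rangle\bigr|^2}{\bigl|\Re\langle L_{\widehat F^{(i)}}e_j,e_j\rangle\bigr|\,\bigl|\Re\langle L_{\widehat F^{(i)}}e_k,e_k\rangle\bigr|}<1,$$ then the switched system is globally uniformly asymptotically stable (GUAS) on $\mathbb{D}^n$, that is: for every commutation law $\sigma$ and every $z_0\in\mathbb{D}^n$ there is a trajectory $z:[0,\infty)\to\mathbb{C}^n$ with $z(0)=z_0$; for every $\epsilon>0$ there is $\delta>0$ such that, for all $\sigma$ and all trajectories, $\|z(0)\|\le\delta$ implies $\|z(t)\|\le\epsilon$ for all $t>0$ and $\lim_{t\to\infty}z(t)=0$; and, for all $\sigma$ and all trajectories, $z(0)\in\mathbb{D}^n$ implies $\lim_{t\to\infty}z(t)=0$. -/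

import Mathlib

open Filter Topology MeasureTheory

noncomputable section

/-! ### Solutions of differential equations and of switched systems -/

section Dynamics

variable {E : Type*} [NormedAddCommGroup E] [NormedSpace ℝ E]

/-- `x` is a solution on `[0, ∞)` of the differential equation `ẋ = f(x)`. -/
def IsSolution (f : E → E) (x : ℝ → E) : Prop :=
  ∀ t : ℝ, 0 ≤ t → HasDerivWithinAt x (f (x t)) (Set.Ici 0) t

/-- `D` is forward invariant for the flow of `f`: solutions that start in `D` stay in `D`. -/
def IsInvariantForward (f : E → E) (D : Set E) : Prop :=
  ∀ x : ℝ → E, IsSolution f x → x 0 ∈ D → ∀ t : ℝ, 0 ≤ t → x t ∈ D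

/-- The equilibrium `xe` of `ẋ = f(x)` is globally asymptotically stable on `D`: solutions
starting in `D` exist for all nonnegative times, `xe` is Lyapunov stable, and all solutions that
start near `xe` or in `D` converge to `xe`. -/
structure IsGloballyAsymptoticallyStable (f : E → E) (xe : E) (D : Set E) : Prop where
  equilibrium : f xe = 0
  complete : ∀ x₀ ∈ D, ∃ x : ℝ → E, IsSolution f x ∧ x 0 = x₀
  stable : ∀ ε > 0, ∃ δ > 0,
    (∀ x : ℝ → E, IsSolution f x → ‖x 0 - xe‖ ≤ δ → ∀ t > 0, ‖x t - xe‖ ≤ ε) ∧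
    (∀ x : ℝ → E, IsSolution f x → ‖x 0 - xe‖ ≤ δ → Tendsto x atTop (𝓝 xe))
  attractive : ∀ x : ℝ → E, IsSolution f x → x 0 ∈ D → Tendsto x atTop (𝓝 xe)

variable {ι : Type*}

/-- `σ` does not switch at time `t`: it is constant in a neighbourhood of `t`. -/
def IsConstantNear (σ : ℝ → ι) (t : ℝ) : Prop :=
  ∀ᶠ s in 𝓝 t, σ s = σ t

/-- A commutation law: a piecewise constant function of time `t ≥ 0` with finitely many
discontinuities on every bounded time interval (the values at negative times play no role). -/
def IsCommutationLaw (σ : ℝ → ι) : Prop :=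
  ∀ T : ℝ, {t : ℝ | 0 < t ∧ t ≤ T ∧ ¬ IsConstantNear σ t}.Finite

/-- `x` is a trajectory on `[0, ∞)` of the switched system `ẋ = F^{(σ)}(x)`: it is continuous, and
between the switching times it solves the equation of the active subsystem. -/
def IsTrajectory (F : ι → E → E) (σ : ℝ → ι) (x : ℝ → E) : Prop :=
  ContinuousOn x (Set.Ici 0) ∧
    ∀ t : ℝ, 0 < t → IsConstantNear σ t → HasDerivAt x (F (σ t) (x t)) t

/-- The common equilibrium `xe` of the subsystems is uniformly asymptotically stable (UAS). -/
def IsUAS (F : ι → E → E) (xe : E) : Prop :=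
  ∀ ε > 0, ∃ δ > 0,
    (∀ (σ : ℝ → ι) (x : ℝ → E), IsCommutationLaw σ → IsTrajectory F σ x →
      ‖x 0 - xe‖ ≤ δ → ∀ t > 0, ‖x t - xe‖ ≤ ε) ∧
    (∀ (σ : ℝ → ι) (x : ℝ → E), IsCommutationLaw σ → IsTrajectory F σ x →
      ‖x 0 - xe‖ ≤ δ → Tendsto x atTop (𝓝 xe))

/-- The common equilibrium `xe` of the subsystems is globally uniformly asymptotically stable
(GUAS) on `D`. The clause `complete` makes explicit that, for every commutation law and every
initial state in `D`, there is a trajectory defined for all nonnegative times. -/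
structure IsGUAS (F : ι → E → E) (xe : E) (D : Set E) : Prop where
  equilibrium : ∀ i, F i xe = 0
  complete : ∀ (σ : ℝ → ι), IsCommutationLaw σ → ∀ x₀ ∈ D,
    ∃ x : ℝ → E, IsTrajectory F σ x ∧ x 0 = x₀
  uas : IsUAS F xe
  attractive : ∀ (σ : ℝ → ι) (x : ℝ → E), IsCommutationLaw σ → IsTrajectory F σ x →
    x 0 ∈ D → Tendsto x atTop (𝓝 xe)

end Dynamics

/-! ### The enumeration of the monomials -/

section Monomials

variable {n : ℕ}

/-- The order on multi-indices: first by total degree, and within one total degree the multi-index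
with the larger entry at the first place of difference comes first
(so `z₁ < z₂ < ⋯ < zₙ < z₁² < z₁z₂ < ⋯`). -/
def MultiIndexLT (β γ : Fin n →₀ ℕ) : Prop :=
  β.degree < γ.degree ∨
    (β.degree = γ.degree ∧ ∃ l, (∀ i < l, β i = γ i) ∧ γ l < β l)

theorem MultiIndexLT.irrefl (β : Fin n →₀ ℕ) : ¬ MultiIndexLT β β := by
  rintro (h | ⟨_, l, _, h⟩) <;> exact lt_irrefl _ h

theorem MultiIndexLT.trans {β γ δ : Fin n →₀ ℕ} (h₁ : MultiIndexLT β γ)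
    (h₂ : MultiIndexLT γ δ) : MultiIndexLT β δ := by
  rcases h₁ with h₁ | ⟨e₁, l, hl, h₁⟩ <;> rcases h₂ with h₂ | ⟨e₂, k, hk, h₂⟩
  · exact Or.inl (h₁.trans h₂)
  · exact Or.inl (e₂ ▸ h₁)
  · exact Or.inl (e₁ ▸ h₂)
  · refine Or.inr ⟨e₁.trans e₂, ?_⟩
    rcases lt_trichotomy l k with h | h | h
    · exact ⟨l, fun i hi => (hl i hi).trans (hk i (hi.trans h)), (hk l h) ▸ h₁⟩
    · subst h
      exact ⟨l, fun i hi => (hl i hi).trans (hk i hi), h₂.trans h₁⟩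
    · exact ⟨k, fun i hi => (hl i (hi.trans h)).trans (hk i hi), (hl k h) ▸ h₂⟩

theorem MultiIndexLT.total {β γ : Fin n →₀ ℕ} (h : β ≠ γ) :
    MultiIndexLT β γ ∨ MultiIndexLT γ β := by
  rcases lt_trichotomy β.degree γ.degree with hd | hd | hd
  · exact Or.inl (Or.inl hd)
  · classical
    have hne : (Finset.univ.filter fun l => β l ≠ γ l).Nonempty := by
      by_contra hc
      apply h
      ext l
      by_contra hl
      exact hc ⟨l, by simpa using hl⟩
    have hm := Finset.min'_mem _ hne
    have hmin : ∀ i < Finset.min' _ hne, β i = γ i := by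
      intro i hi
      by_contra hc
      exact absurd (Finset.min'_le _ i (by simpa using hc)) (not_le.mpr hi)
    have hm' : β (Finset.min' _ hne) ≠ γ (Finset.min' _ hne) := by simpa using hm
    rcases lt_or_gt_of_ne hm' with hl | hl
    · exact Or.inr (Or.inr ⟨hd.symm, _, fun i hi => (hmin i hi).symm, hl⟩)
    · exact Or.inl (Or.inr ⟨hd, _, hmin, hl⟩)
  · exact Or.inr (Or.inl hd)

theorem MultiIndexLT.finite_setOf (γ : Fin n →₀ ℕ) : {β | MultiIndexLT β γ}.Finite := by
  refine (Finsupp.finite_of_degree_le γ.degree).subset ?_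
  rintro β (h | ⟨h, _⟩)
  · exact h.le
  · exact h.le

/-- The position of a multi-index in the enumeration: the number of its predecessors. -/
def multiIndexRank (γ : Fin n →₀ ℕ) : ℕ :=
  {β | MultiIndexLT β γ}.ncard

theorem multiIndexRank_lt {β γ : Fin n →₀ ℕ} (h : MultiIndexLT β γ) :
    multiIndexRank β < multiIndexRank γ :=
  Set.ncard_lt_ncard ⟨fun _ hδ => MultiIndexLT.trans hδ h,
    fun hs => MultiIndexLT.irrefl β (hs h)⟩ (MultiIndexLT.finite_setOf γ)

theorem multiIndexRank_injective :
    Function.Injective (multiIndexRank : (Fin n →₀ ℕ) → ℕ) := by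
  intro β γ h
  by_contra hne
  rcases MultiIndexLT.total hne with h' | h'
  · exact absurd h (multiIndexRank_lt h').ne
  · exact absurd h (multiIndexRank_lt h').ne'

theorem multiIndexRank_bijective [NeZero n] :
    Function.Bijective (multiIndexRank : (Fin n →₀ ℕ) → ℕ) := by
  refine ⟨multiIndexRank_injective, fun k => ?_⟩
  have : Infinite (Fin n →₀ ℕ) :=
    Infinite.of_injective (fun a : ℕ => Finsupp.single (0 : Fin n) a)
      (Finsupp.single_injective 0)
  obtain ⟨_, ⟨γ, rfl⟩, hγ⟩ :=
    (Set.infinite_range_of_injective (multiIndexRank_injective (n := n))).exists_gt k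
  have hsub : multiIndexRank '' {β | MultiIndexLT β γ} ⊆ Set.Iio (multiIndexRank γ) := by
    rintro _ ⟨β, hβ, rfl⟩
    exact multiIndexRank_lt hβ
  have heq := Set.eq_of_subset_of_ncard_le hsub (by
    rw [Set.ncard_image_of_injective _ multiIndexRank_injective]
    simp [Set.ncard_eq_toFinset_card', multiIndexRank]) (Set.finite_Iio _)
  obtain ⟨β, _, hβ⟩ := heq.symm ▸ (show k ∈ Set.Iio (multiIndexRank γ) from hγ)
  exact ⟨β, hβ⟩

/-- The enumeration `k ↦ α(k)` of the multi-indices in increasing order, with `α(0) = 0`. -/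
def multiIndex (n : ℕ) [NeZero n] : ℕ ≃ (Fin n →₀ ℕ) :=
  (Equiv.ofBijective _ multiIndexRank_bijective).symm

theorem multiIndex_lt_iff [NeZero n] {j k : ℕ} :
    MultiIndexLT (multiIndex n k) (multiIndex n j) ↔ k < j := by
  have hr : ∀ i, multiIndexRank (multiIndex n i) = i := fun i =>
    (Equiv.ofBijective _ multiIndexRank_bijective).apply_symm_apply i
  refine ⟨fun h => by simpa only [hr] using multiIndexRank_lt h, fun h => ?_⟩
  have hne : multiIndex n k ≠ multiIndex n j := fun he => h.ne ((multiIndex n).injective he)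
  rcases MultiIndexLT.total hne with h' | h'
  · exact h'
  · exact absurd (by simpa only [hr] using multiIndexRank_lt h') (not_lt.mpr h.le)

/-- The monomial function `e_k(z) = z^{α(k)}` on `ℂⁿ`. -/
def monomialFun [NeZero n] (k : ℕ) (z : Fin n → ℂ) : ℂ :=
  ∏ l, z l ^ multiIndex n k l

end Monomials

/-! ### The polydisk, the Hardy inner product and the Koopman generator -/

section Koopman

variable {n : ℕ}

/-- The polydisk `𝔻ⁿ(0, ρ)`. -/
def polydisk (n : ℕ) (ρ : ℝ) : Set (Fin n → ℂ) :=
  {z | ∀ l, ‖z l‖ < ρ}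

/-- The inner product `⟨f, g⟩ = ∫ f(ω) conj (g(ω)) dm(ω)` of the Hardy space on the unit polydisk,
for functions given up to the distinguished boundary (such as polynomials); `m` is the normalized
Lebesgue measure on the torus `(∂𝔻)ⁿ`, parametrized by `ω_l = exp(2πi t_l)`. -/
def hardyInner (f g : (Fin n → ℂ) → ℂ) : ℂ :=
  ∫ t : Fin n → UnitAddCircle,
    f (fun l => (AddCircle.toCircle (t l) : ℂ)) *
      (starRingEnd ℂ) (g (fun l => (AddCircle.toCircle (t l) : ℂ)))
    ∂(Measure.pi fun _ => (AddCircle.haarAddCircle : Measure UnitAddCircle))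

/-- The Koopman generator `L_F f = F · ∇f`. -/
def koopmanGenerator (F : (Fin n → ℂ) → (Fin n → ℂ)) (f : (Fin n → ℂ) → ℂ) :
    (Fin n → ℂ) → ℂ :=
  fun z => fderiv ℂ f z (F z)

/-- The entry `⟨L_F e_k, e_j⟩` of the Koopman matrix. -/
def koopmanEntry [NeZero n] (F : (Fin n → ℂ) → (Fin n → ℂ)) (k j : ℕ) : ℂ :=
  hardyInner (koopmanGenerator F (monomialFun k)) (monomialFun j)

end Koopman

/-! ### Polynomial vector fields -/

section Polynomial

variable {n : ℕ}

/-- The vector field on `ℂⁿ` with polynomial components `F_l`. -/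
def polyField (F : Fin n → MvPolynomial (Fin n) ℂ) (z : Fin n → ℂ) : Fin n → ℂ :=
  fun l => MvPolynomial.eval z (F l)

/-- The Jacobian matrix `JF(0)`. -/
def jacobianZero (F : Fin n → MvPolynomial (Fin n) ℂ) : Matrix (Fin n) (Fin n) ℂ :=
  Matrix.of fun l q => MvPolynomial.eval 0 (MvPolynomial.pderiv q (F l))

/-- `0` is a hyperbolic stable equilibrium: `F(0) = 0` and every eigenvalue of `JF(0)` has
negative real part. -/
def IsHyperbolicStableZero (F : Fin n → MvPolynomial (Fin n) ℂ) : Prop :=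
  polyField F 0 = 0 ∧
    ∀ μ : ℂ, Module.End.HasEigenvalue (Matrix.toLin' (jacobianZero F)) μ → μ.re < 0

/-- The vector field `F̂(ẑ) = P⁻¹ F(P ẑ)` in the coordinates `ẑ = P⁻¹ z`. -/
def changeCoords (P : Matrix (Fin n) (Fin n) ℂ) (F : Fin n → MvPolynomial (Fin n) ℂ) :
    Fin n → MvPolynomial (Fin n) ℂ :=
  fun l => ∑ q, MvPolynomial.C (P⁻¹ l q) *
    MvPolynomial.bind₁ (fun s => ∑ r, MvPolynomial.C (P s r) * MvPolynomial.X r) (F q)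

theorem polyField_changeCoords (P : Matrix (Fin n) (Fin n) ℂ)
    (F : Fin n → MvPolynomial (Fin n) ℂ) (z : Fin n → ℂ) :
    polyField (changeCoords P F) z = P⁻¹.mulVec (polyField F (P.mulVec z)) := by
  funext l
  simp only [polyField, changeCoords, map_sum, map_mul, MvPolynomial.eval_C, Matrix.mulVec,
    dotProduct]
  refine Finset.sum_congr rfl fun q _ => ?_
  congr 1
  rw [← MvPolynomial.coe_aeval_eq_eval, RingHom.coe_coe, MvPolynomial.aeval_bind₁]
  simp [MvPolynomial.aeval_eq_eval]
  rfl

/-- The number of nonzero terms of a polynomial vector field, where the monomial `z_l` in the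
component `F_l` is not counted. -/
def numTerms (F : Fin n → MvPolynomial (Fin n) ℂ) : ℕ :=
  ∑ l, ((F l).support.erase (Finsupp.single l 1)).card

/-- The matrix norm `‖A‖_∞` induced by the supremum norm of `ℂⁿ` (the maximal row sum). -/
def matrixSupNorm (A : Matrix (Fin n) (Fin n) ℂ) : ℝ :=
  letI := Matrix.linftyOpNormedAddCommGroup (m := Fin n) (n := Fin n) (α := ℂ)
  ‖A‖

section Solvable

attribute [local instance] LieRing.ofAssociativeRing

/-- The complex Lie algebra of matrices generated by the `A⁽ⁱ⁾`, with the commutator as bracket,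
is solvable. -/
def GeneratesSolvable {ι : Type*} (A : ι → Matrix (Fin n) (Fin n) ℂ) : Prop :=
  LieAlgebra.IsSolvable (LieSubalgebra.lieSpan ℂ (Matrix (Fin n) (Fin n) ℂ) (Set.range A))

end Solvable

/-- `P` is an invertible matrix, normalized by `‖P⁻¹‖_∞ = 1`, such that all the matrices
`P⁻¹ A⁽ⁱ⁾ P` are upper triangular. -/
structure IsTriangularizer {ι : Type*} (A : ι → Matrix (Fin n) (Fin n) ℂ)
    (P : Matrix (Fin n) (Fin n) ℂ) : Prop where
  isUnit_det : IsUnit P.det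
  norm_inv : matrixSupNorm P⁻¹ = 1
  upper : ∀ (i : ι) (l q : Fin n), q < l → (P⁻¹ * A i * P) l q = 0

/-- The quantity
`K² |⟨L_F e_k, e_j⟩|² / (|Re ⟨L_F e_j, e_j⟩| |Re ⟨L_F e_k, e_k⟩|)`, with `K` the number of nonzero
terms of `F`. -/
def couplingRatio [NeZero n] (F : Fin n → MvPolynomial (Fin n) ℂ) (j k : ℕ) : ℝ :=
  (numTerms F : ℝ) ^ 2 * ‖koopmanEntry (polyField F) k j‖ ^ 2 /
    (|(koopmanEntry (polyField F) j j).re| * |(koopmanEntry (polyField F) k k).re|)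

end Polynomial

end

/-!
In the Hardy space the monomials are orthonormal, so the entry `⟨L_F e_k, e_j⟩` of the Koopman
matrix is the coefficient of `e_j` in `L_F e_k`. By Lie's theorem a linear change of coordinates
makes all the Jacobian matrices at the origin upper triangular; in the chosen order of the monomials
the Koopman matrices are then triangular, their diagonal entries have negative real parts
proportional to the degree, and every row and every column has at most `K` nonzero off-diagonal
entries, with `K` the number of terms of the vector field.

The condition on the coupling ratios supplies bounded weights `ε_k ≥ 1`, growing geometrically up to
a finite index and constant from there on, such that `ε_k` times the `(j, k)`-th ratio is at most
`q ε_j` for some `q < 1`. By the inequality of arithmetic and geometric means the truncations `V_N`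
of `V = ∑ ε_k |e_k|²` then satisfy `V_N' ≤ -2 (1 - √q) c V_N + η_N` along every subsystem, where
`-c` bounds the real parts of the eigenvalues and `η_N → 0` uniformly on every smaller polydisk.
A trajectory stays in such a polydisk during a bounded time interval, so Grönwall's inequality and
`N → ∞` give exponential decay of `V`, at a rate that does not depend on the commutation law.
-/

noncomputable section

section FourierOrthogonality

theorem integral_fourier_haarAddCircle {T : ℝ} [Fact (0 < T)] (k : ℤ) :
    ∫ t : AddCircle T, fourier k t ∂AddCircle.haarAddCircle = if k = 0 then 1 else 0 := by
  split_ifs with h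
  · simp [h]
  · exact integral_eq_zero_of_add_right_eq_neg (μ := AddCircle.haarAddCircle)
      (fourier_add_half_inv_index h Fact.out)

variable {n : ℕ}

theorem hardyInner_prod_pow (β γ : Fin n →₀ ℕ) :
    hardyInner (fun z => ∏ l, z l ^ β l) (fun z => ∏ l, z l ^ γ l) = if β = γ then 1 else 0 := by
  have integrand_eq : ∀ t : Fin n → UnitAddCircle,
      (∏ l, (AddCircle.toCircle (t l) : ℂ) ^ β l) *
        (starRingEnd ℂ) (∏ l, (AddCircle.toCircle (t l) : ℂ) ^ γ l) =
      ∏ l, fourier ((β l : ℤ) - γ l) (t l) := by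
    intro t
    rw [map_prod, ← Finset.prod_mul_distrib]
    refine Finset.prod_congr rfl fun l _ => ?_
    rw [sub_eq_add_neg, fourier_add, fourier_neg, map_pow]
    simp [fourier_apply, AddCircle.toCircle_nsmul]
  simp_rw [hardyInner, integrand_eq]
  rw [integral_fintype_prod_eq_prod (f := fun l t => (fourier ((β l : ℤ) - γ l) t : ℂ))]
  simp_rw [integral_fourier_haarAddCircle, sub_eq_zero, Nat.cast_inj, Finset.prod_ite_zero,
    Finset.prod_const_one, Finset.mem_univ, true_imp_iff, ← DFunLike.ext_iff]

theorem hardyInner_eval_prod_pow (p : MvPolynomial (Fin n) ℂ) (γ : Fin n →₀ ℕ) :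
    hardyInner (fun z => MvPolynomial.eval z p) (fun z => ∏ l, z l ^ γ l) = p.coeff γ := by
  have continuous_integrand : ∀ β : Fin n →₀ ℕ, Continuous fun t : Fin n → UnitAddCircle =>
      (∏ l, (AddCircle.toCircle (t l) : ℂ) ^ β l) *
        (starRingEnd ℂ) (∏ l, (AddCircle.toCircle (t l) : ℂ) ^ γ l) := by
    have : ∀ l : Fin n, Continuous fun t : Fin n → UnitAddCircle =>
        (AddCircle.toCircle (t l) : ℂ) := fun l =>
      continuous_subtype_val.comp (AddCircle.continuous_toCircle.comp (continuous_apply l))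
    exact fun β => .mul (by fun_prop) (Complex.continuous_conj.comp (by fun_prop))
  have orthonormal := fun β : Fin n →₀ ℕ => hardyInner_prod_pow β γ
  unfold hardyInner at orthonormal ⊢
  simp_rw [MvPolynomial.eval_eq', Finset.sum_mul, mul_assoc]
  rw [integral_finsetSum]
  · simp_rw [integral_const_mul, orthonormal]
    simp +contextual [eq_comm]
  · exact fun β _ => ((continuous_integrand β).integrable_of_hasCompactSupport
      (HasCompactSupport.of_compactSpace _)).const_mul _

end FourierOrthogonality

section PolynomialDerivatives

theorem hasFDerivAt_mvPolynomial_eval {𝕜 σ : Type*} [NontriviallyNormedField 𝕜] [Fintype σ]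
    (p : MvPolynomial σ 𝕜) (z : σ → 𝕜) :
    HasFDerivAt (fun w => MvPolynomial.eval w p)
      (∑ q, MvPolynomial.eval z (MvPolynomial.pderiv q p) •
        ContinuousLinearMap.proj (R := 𝕜) (φ := fun _ : σ => 𝕜) q) z := by
  classical
  induction p using MvPolynomial.induction_on with
  | C a =>
    simp only [MvPolynomial.eval_C]
    refine (hasFDerivAt_const a z).congr_fderiv ?_
    ext v
    simp
  | add p q hp hq =>
    simp only [map_add]
    refine (hp.add hq).congr_fderiv ?_
    ext v
    simp [add_mul, Finset.sum_add_distrib]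
  | mul_X p i hp =>
    simp only [map_mul, MvPolynomial.eval_X]
    refine (hp.mul (hasFDerivAt_apply (𝕜 := 𝕜) (F' := fun _ : σ => 𝕜) i z)).congr_fderiv ?_
    ext v
    simp [Derivation.leibniz, Pi.single_apply, apply_ite, add_mul, Finset.sum_add_distrib,
      Finset.mul_sum, mul_assoc]

variable {n : ℕ}

theorem hasFDerivAt_polyField (F : Fin n → MvPolynomial (Fin n) ℂ) (z : Fin n → ℂ) :
    HasFDerivAt (polyField F) (ContinuousLinearMap.pi fun l =>
      ∑ q, MvPolynomial.eval z (MvPolynomial.pderiv q (F l)) •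
        ContinuousLinearMap.proj (R := ℂ) (φ := fun _ : Fin n => ℂ) q) z :=
  hasFDerivAt_pi.2 fun l => hasFDerivAt_mvPolynomial_eval (F l) z

theorem hasFDerivAt_polyField_zero (F : Fin n → MvPolynomial (Fin n) ℂ) :
    HasFDerivAt (polyField F) (LinearMap.toContinuousLinearMap (jacobianZero F).mulVecLin) 0 := by
  refine (hasFDerivAt_polyField F 0).congr_fderiv ?_
  ext v l
  simp [jacobianZero, Matrix.mulVec, dotProduct]

theorem jacobianZero_changeCoords (P : Matrix (Fin n) (Fin n) ℂ)
    (F : Fin n → MvPolynomial (Fin n) ℂ) :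
    jacobianZero (changeCoords P F) = P⁻¹ * jacobianZero F * P := by
  have linear (Q : Matrix (Fin n) (Fin n) ℂ) (z : Fin n → ℂ) :
      HasFDerivAt Q.mulVec (LinearMap.toContinuousLinearMap Q.mulVecLin) z :=
    (LinearMap.toContinuousLinearMap Q.mulVecLin).hasFDerivAt
  have chain_rule : HasFDerivAt (polyField (changeCoords P F))
      (LinearMap.toContinuousLinearMap (P⁻¹ * jacobianZero F * P).mulVecLin) 0 := by
    have hF := hasFDerivAt_polyField_zero F
    rw [← P.mulVec_zero] at hF
    rw [funext (polyField_changeCoords P F)]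
    refine ((linear P⁻¹ _).comp 0 (hF.comp 0 (linear P 0))).congr_fderiv ?_
    ext v
    simp [Matrix.mulVec_mulVec, Matrix.mul_assoc]
  have derivatives_eq := (hasFDerivAt_polyField_zero (changeCoords P F)).unique chain_rule
  exact Matrix.mulVec_injective (congrArg DFunLike.coe derivatives_eq)

theorem coeff_single_eq_jacobianZero (F : Fin n → MvPolynomial (Fin n) ℂ) (l q : Fin n) :
    (F l).coeff (Finsupp.single q 1) = jacobianZero F l q := by
  simp [jacobianZero, MvPolynomial.eval_zero, MvPolynomial.constantCoeff_eq,
    MvPolynomial.coeff_pderiv]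

theorem coeff_zero_eq_polyField_zero (F : Fin n → MvPolynomial (Fin n) ℂ) (l : Fin n) :
    (F l).coeff 0 = polyField F 0 l := by
  simp [polyField, MvPolynomial.constantCoeff_eq]

end PolynomialDerivatives

section KoopmanExpansion

variable {n : ℕ}

/-- The Koopman generator of a polynomial vector field, acting on polynomials. -/
def koopmanDerivation (F : Fin n → MvPolynomial (Fin n) ℂ) :
    Derivation ℂ (MvPolynomial (Fin n) ℂ) (MvPolynomial (Fin n) ℂ) :=
  ∑ l, F l • MvPolynomial.pderiv l

theorem koopmanDerivation_apply (F : Fin n → MvPolynomial (Fin n) ℂ)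
    (p : MvPolynomial (Fin n) ℂ) :
    koopmanDerivation F p = ∑ l, F l * MvPolynomial.pderiv l p := by
  have := congrFun
    (map_sum Derivation.coeFnAddMonoidHom (fun l => F l • MvPolynomial.pderiv l) Finset.univ) p
  rwa [Finset.sum_apply] at this

theorem koopmanGenerator_eval (F : Fin n → MvPolynomial (Fin n) ℂ) (p : MvPolynomial (Fin n) ℂ)
    (z : Fin n → ℂ) :
    koopmanGenerator (polyField F) (fun w => MvPolynomial.eval w p) z =
      MvPolynomial.eval z (koopmanDerivation F p) := by
  rw [koopmanGenerator, (hasFDerivAt_mvPolynomial_eval p z).fderiv]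
  simp [koopmanDerivation_apply, polyField, mul_comm]

variable [NeZero n]

theorem monomialFun_eq_eval (k : ℕ) :
    (monomialFun k : (Fin n → ℂ) → ℂ) =
      fun z => MvPolynomial.eval z (MvPolynomial.monomial (multiIndex n k) 1) := by
  ext z
  simp [monomialFun, MvPolynomial.eval_monomial, Finsupp.prod_fintype]

theorem differentiable_monomialFun (k : ℕ) :
    Differentiable ℂ (monomialFun k : (Fin n → ℂ) → ℂ) := by
  rw [monomialFun_eq_eval]
  exact fun z => (hasFDerivAt_mvPolynomial_eval _ z).differentiableAt

theorem koopmanGenerator_monomialFun (F : Fin n → MvPolynomial (Fin n) ℂ) (k : ℕ) :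
    koopmanGenerator (polyField F) (monomialFun k) = fun z =>
      MvPolynomial.eval z (koopmanDerivation F (MvPolynomial.monomial (multiIndex n k) 1)) := by
  rw [monomialFun_eq_eval]
  exact funext (koopmanGenerator_eval F _)

theorem koopmanEntry_eq_coeff (F : Fin n → MvPolynomial (Fin n) ℂ) (k j : ℕ) :
    koopmanEntry (polyField F) k j =
      (koopmanDerivation F (MvPolynomial.monomial (multiIndex n k) 1)).coeff (multiIndex n j) := by
  rw [koopmanEntry, koopmanGenerator_monomialFun]
  exact hardyInner_eval_prod_pow _ _

theorem eventually_koopmanGenerator_monomialFun_eq_sum (F : Fin n → MvPolynomial (Fin n) ℂ)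
    (k : ℕ) :
    ∀ᶠ M in atTop, ∀ z, koopmanGenerator (polyField F) (monomialFun k) z =
      ∑ j ∈ Finset.range M, koopmanEntry (polyField F) k j * monomialFun j z := by
  set p := koopmanDerivation F (MvPolynomial.monomial (multiIndex n k) 1)
  obtain ⟨M₀, hM₀⟩ := (p.support.map (multiIndex n).symm.toEmbedding).exists_nat_subset_range
  filter_upwards [eventually_ge_atTop M₀] with M hM z
  simp only [koopmanGenerator_monomialFun, koopmanEntry_eq_coeff]
  rw [← Finset.sum_subset (hM₀.trans (Finset.range_mono hM)), MvPolynomial.eval_eq',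
    Finset.sum_map]
  · simp [monomialFun, p]
  · intro j _ hj
    have : multiIndex n j ∉ p.support := fun h => hj (Finset.mem_map.2 ⟨_, h, by simp⟩)
    rw [MvPolynomial.notMem_support_iff.1 this, zero_mul]

theorem koopmanEntry_eq_sum (F : Fin n → MvPolynomial (Fin n) ℂ) (k j : ℕ) :
    koopmanEntry (polyField F) k j = ∑ l,
      if multiIndex n k - Finsupp.single l 1 ≤ multiIndex n j then
        (multiIndex n k l : ℂ) *
          (F l).coeff (multiIndex n j - (multiIndex n k - Finsupp.single l 1))
      else 0 := by
  rw [koopmanEntry_eq_coeff, koopmanDerivation_apply, MvPolynomial.coeff_sum]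
  refine Finset.sum_congr rfl fun l _ => ?_
  rw [mul_comm, MvPolynomial.pderiv_monomial, MvPolynomial.coeff_monomial_mul', one_mul]

end KoopmanExpansion

section KoopmanMatrix

variable {n : ℕ}

theorem MultiIndexLT.of_add_single_eq_of_one_lt_degree {β γ δ : Fin n →₀ ℕ} {l : Fin n}
    (h : γ + Finsupp.single l 1 = β + δ) (hδ : 1 < δ.degree) : MultiIndexLT β γ := by
  have hdeg := congrArg Finsupp.degree h
  simp only [map_add, Finsupp.degree_single] at hdeg
  exact Or.inl (by omega)

theorem MultiIndexLT.of_add_single_eq_add_single {β γ : Fin n →₀ ℕ} {l q : Fin n}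
    (h : γ + Finsupp.single l 1 = β + Finsupp.single q 1) (hlq : l < q) : MultiIndexLT β γ := by
  have hdeg := congrArg Finsupp.degree h
  simp only [map_add, Finsupp.degree_single] at hdeg
  refine Or.inr ⟨by omega, l, fun i hi => ?_, ?_⟩
  · simpa [hi.ne', (hi.trans hlq).ne'] using (DFunLike.congr_fun h i).symm
  · have := DFunLike.congr_fun h l
    simp only [Finsupp.add_apply, Finsupp.single_eq_same, Finsupp.single_eq_of_ne hlq.ne] at this
    omega

theorem one_lt_degree_or_exists_eq_single {F : Fin n → MvPolynomial (Fin n) ℂ}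
    (hzero : polyField F 0 = 0) (htri : (jacobianZero F).IsUpperTriangular) {l : Fin n}
    {δ : Fin n →₀ ℕ} (hδ : δ ∈ (F l).support) :
    1 < δ.degree ∨ ∃ q, l ≤ q ∧ δ = Finsupp.single q 1 := by
  rw [MvPolynomial.mem_support_iff] at hδ
  rcases lt_trichotomy 1 δ.degree with hdeg | hdeg | hdeg
  · exact .inl hdeg
  · obtain ⟨q, rfl⟩ : δ ∈ Set.range fun q : Fin n => Finsupp.single q 1 := by
      rw [Finsupp.range_single_one]
      exact hdeg.symm
    refine .inr ⟨q, not_lt.1 fun hql => hδ ?_, rfl⟩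
    rw [coeff_single_eq_jacobianZero, htri hql]
  · rw [Nat.lt_one_iff, Finsupp.degree_eq_zero_iff] at hdeg
    exact absurd (by rw [hdeg, coeff_zero_eq_polyField_zero, hzero, Pi.zero_apply]) hδ

/-- The terms of a polynomial vector field, except for the terms `z_l` of the components `F_l`: a
term `z^δ` of `F_l` is encoded as the pair `⟨l, δ⟩`. These are the terms counted by `numTerms`, and
those that produce the off-diagonal entries of the Koopman matrix. -/
def offDiagonalTerms (F : Fin n → MvPolynomial (Fin n) ℂ) : Finset (Σ _ : Fin n, Fin n →₀ ℕ) :=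
  Finset.univ.sigma fun l => (F l).support.erase (Finsupp.single l 1)

theorem card_offDiagonalTerms (F : Fin n → MvPolynomial (Fin n) ℂ) :
    (offDiagonalTerms F).card = numTerms F :=
  Finset.card_sigma _ _

variable [NeZero n] {F : Fin n → MvPolynomial (Fin n) ℂ} {k j : ℕ}

theorem exists_mem_support_of_koopmanEntry_ne_zero (h : koopmanEntry (polyField F) k j ≠ 0) :
    ∃ l, ∃ δ ∈ (F l).support,
      multiIndex n j + Finsupp.single l 1 = multiIndex n k + δ := by
  rw [koopmanEntry_eq_sum] at h
  obtain ⟨l, _, hl⟩ := Finset.exists_ne_zero_of_sum_ne_zero h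
  obtain ⟨hle, hl⟩ := (ite_ne_right_iff.1 hl)
  have hk : Finsupp.single l 1 ≤ multiIndex n k := by
    simpa [Nat.one_le_iff_ne_zero] using left_ne_zero_of_mul hl
  refine ⟨l, _, MvPolynomial.mem_support_iff.2 (right_ne_zero_of_mul hl), ?_⟩
  calc multiIndex n j + Finsupp.single l 1
      = (multiIndex n k - Finsupp.single l 1) +
        (multiIndex n j - (multiIndex n k - Finsupp.single l 1)) + Finsupp.single l 1 := by
        rw [add_tsub_cancel_of_le hle]
    _ = (multiIndex n k - Finsupp.single l 1) + Finsupp.single l 1 +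
        (multiIndex n j - (multiIndex n k - Finsupp.single l 1)) := add_right_comm _ _ _
    _ = _ := by rw [tsub_add_cancel_of_le hk]

theorem exists_mem_offDiagonalTerms_of_koopmanEntry_ne_zero (hkj : k ≠ j)
    (h : koopmanEntry (polyField F) k j ≠ 0) :
    ∃ b ∈ offDiagonalTerms F, multiIndex n j + Finsupp.single b.1 1 = multiIndex n k + b.2 := by
  obtain ⟨l, δ, hδ, heq⟩ := exists_mem_support_of_koopmanEntry_ne_zero h
  have hδl : δ ≠ Finsupp.single l 1 := by
    rintro rfl
    exact hkj ((multiIndex n).injective (add_right_cancel heq)).symm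
  exact ⟨⟨l, δ⟩, Finset.mem_sigma.2 ⟨Finset.mem_univ l, Finset.mem_erase.2 ⟨hδl, hδ⟩⟩, heq⟩

theorem card_koopmanEntry_row_le (F : Fin n → MvPolynomial (Fin n) ℂ) (k : ℕ) (t : Finset ℕ) :
    (t.filter fun j => k ≠ j ∧ koopmanEntry (polyField F) k j ≠ 0).card ≤ numTerms F := by
  rw [← card_offDiagonalTerms]
  refine Finset.card_le_card_of_forall_subsingleton
    (fun j b => multiIndex n j + Finsupp.single b.1 1 = multiIndex n k + b.2) ?_ ?_
  · intro j hj
    obtain ⟨hkj, hne⟩ := (Finset.mem_filter.1 hj).2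
    exact exists_mem_offDiagonalTerms_of_koopmanEntry_ne_zero hkj hne
  · rintro b - j ⟨-, hj⟩ j' ⟨-, hj'⟩
    exact (multiIndex n).injective (add_right_cancel (hj.trans hj'.symm))

theorem card_koopmanEntry_column_le (F : Fin n → MvPolynomial (Fin n) ℂ) (j : ℕ)
    (s : Finset ℕ) :
    (s.filter fun k => k ≠ j ∧ koopmanEntry (polyField F) k j ≠ 0).card ≤ numTerms F := by
  rw [← card_offDiagonalTerms]
  refine Finset.card_le_card_of_forall_subsingleton
    (fun k b => multiIndex n j + Finsupp.single b.1 1 = multiIndex n k + b.2) ?_ ?_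
  · intro k hk
    obtain ⟨hkj, hne⟩ := (Finset.mem_filter.1 hk).2
    exact exists_mem_offDiagonalTerms_of_koopmanEntry_ne_zero hkj hne
  · rintro b - k ⟨-, hk⟩ k' ⟨-, hk'⟩
    exact (multiIndex n).injective (add_right_cancel (hk.symm.trans hk'))

theorem le_of_koopmanEntry_ne_zero (hzero : polyField F 0 = 0)
    (htri : (jacobianZero F).IsUpperTriangular) (h : koopmanEntry (polyField F) k j ≠ 0) :
    k ≤ j := by
  obtain ⟨l, δ, hδ, heq⟩ := exists_mem_support_of_koopmanEntry_ne_zero h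
  rcases one_lt_degree_or_exists_eq_single hzero htri hδ with hdeg | ⟨q, hlq, rfl⟩
  · exact (multiIndex_lt_iff.1 (.of_add_single_eq_of_one_lt_degree heq hdeg)).le
  · rcases hlq.eq_or_lt with rfl | hlq
    · exact ((multiIndex n).injective (add_right_cancel heq)).ge
    · exact (multiIndex_lt_iff.1 (.of_add_single_eq_add_single heq hlq)).le

theorem koopmanEntry_self (F : Fin n → MvPolynomial (Fin n) ℂ) (k : ℕ) :
    koopmanEntry (polyField F) k k = ∑ l, (multiIndex n k l : ℂ) * jacobianZero F l l := by
  rw [koopmanEntry_eq_sum]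
  refine Finset.sum_congr rfl fun l _ => ?_
  rw [if_pos tsub_le_self]
  rcases eq_or_ne (multiIndex n k l) 0 with h | h
  · simp [h]
  · rw [tsub_tsub_cancel_of_le (by simpa [Nat.one_le_iff_ne_zero] using h),
      coeff_single_eq_jacobianZero]

theorem multiIndex_zero : multiIndex n 0 = 0 := by
  obtain ⟨k, hk⟩ := (multiIndex n).surjective 0
  have not_lt : ¬ MultiIndexLT (multiIndex n 0) 0 := by
    rintro (h | ⟨heq, l, -, hl⟩)
    · simp at h
    · have h0 : multiIndex n 0 = 0 :=
        (Finsupp.degree_eq_zero_iff _).1 (heq.trans (map_zero Finsupp.degree))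
      simp [h0] at hl
  rw [← hk, multiIndex_lt_iff, Nat.not_lt, Nat.le_zero] at not_lt
  rwa [not_lt] at hk

theorem degree_multiIndex_pos (hk : k ≠ 0) : 0 < (multiIndex n k).degree := by
  rw [Nat.pos_iff_ne_zero, Ne, Finsupp.degree_eq_zero_iff, ← multiIndex_zero]
  exact (multiIndex n).injective.ne hk

end KoopmanMatrix

section TriangularEigenvalues

theorem hasEigenvalue_toLin'_of_isUpperTriangular_conj {ι K : Type*} [Fintype ι] [LinearOrder ι]
    [Field K] {A P : Matrix ι ι K} (hP : IsUnit P.det)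
    (htri : (P⁻¹ * A * P).IsUpperTriangular) (l : ι) :
    Module.End.HasEigenvalue (Matrix.toLin' A) ((P⁻¹ * A * P) l l) := by
  have charpoly_conj : (P⁻¹ * A * P).charpoly = A.charpoly :=
    Matrix.charpoly_units_conj' (P.nonsingInvUnit hP) A
  rw [Module.End.hasEigenvalue_iff_isRoot_charpoly, Matrix.charpoly_toLin', ← charpoly_conj,
    Matrix.charpoly_of_isUpperTriangular _ htri, Polynomial.IsRoot, Polynomial.eval_prod]
  exact Finset.prod_eq_zero (Finset.mem_univ l) (by simp)

end TriangularEigenvalues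

section WeightedSums

theorem two_mul_le_sqrt_mul_add {b q u v : ℝ} (hq : 0 ≤ q) (huv : 0 ≤ u + v)
    (h : b ^ 2 ≤ q * (u * v)) : 2 * b ≤ √q * (u + v) := by
  refine (abs_le_of_sq_le_sq' ?_ (by positivity)).2
  calc (2 * b) ^ 2 ≤ q * (4 * u * v) := by linarith
    _ ≤ q * (u + v) ^ 2 := by gcongr; exact four_mul_le_sq_add u v
    _ = (√q * (u + v)) ^ 2 := by rw [mul_pow, Real.sq_sqrt hq]

variable {ι κ : Type*}

theorem sum_sum_filter_add_le {r : ι → κ → Prop} [∀ k j, Decidable (r k j)] {s : Finset ι}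
    {t : Finset κ} {K : ℕ} (hrow : ∀ k ∈ s, (t.filter fun j => r k j).card ≤ K)
    (hcol : ∀ j ∈ t, (s.filter fun k => r k j).card ≤ K) {u : ι → ℝ} {v : κ → ℝ}
    (hu : ∀ k ∈ s, 0 ≤ u k) (hv : ∀ j ∈ t, 0 ≤ v j) :
    ∑ k ∈ s, ∑ j ∈ t with r k j, (u k + v j) ≤ K * (∑ k ∈ s, u k + ∑ j ∈ t, v j) := by
  have row_sums : ∑ k ∈ s, ∑ j ∈ t with r k j, u k ≤ K * ∑ k ∈ s, u k := by
    simp_rw [Finset.sum_const, nsmul_eq_mul, Finset.mul_sum]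
    exact Finset.sum_le_sum fun k hk =>
      mul_le_mul_of_nonneg_right (Nat.cast_le.2 (hrow k hk)) (hu k hk)
  have column_sums : ∑ k ∈ s, ∑ j ∈ t with r k j, v j ≤ K * ∑ j ∈ t, v j := by
    rw [Finset.sum_comm' (t' := t) (s' := fun j => s.filter fun k => r k j) (by simp; tauto)]
    simp_rw [Finset.sum_const, nsmul_eq_mul, Finset.mul_sum]
    exact Finset.sum_le_sum fun j hj =>
      mul_le_mul_of_nonneg_right (Nat.cast_le.2 (hcol j hj)) (hv j hj)
  simp_rw [Finset.sum_add_distrib, mul_add]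
  exact add_le_add row_sums column_sums

theorem two_mul_re_conj_mul_le {K q ε₁ ε₂ R₁ R₂ : ℝ} {a x y : ℂ} (hK : 0 ≤ K) (hq : 0 ≤ q)
    (hε₁ : 0 ≤ ε₁) (hε₂ : 0 ≤ ε₂) (hR₁ : 0 ≤ R₁) (hR₂ : 0 ≤ R₂)
    (h : ε₁ * (K ^ 2 * ‖a‖ ^ 2) ≤ q * ε₂ * (R₂ * R₁)) :
    2 * (K * (ε₁ * ((starRingEnd ℂ) x * (a * y)).re)) ≤
      √q * (ε₁ * R₁ * ‖x‖ ^ 2 + ε₂ * R₂ * ‖y‖ ^ 2) := by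
  have re_le : ((starRingEnd ℂ) x * (a * y)).re ≤ ‖x‖ * (‖a‖ * ‖y‖) := by
    simpa only [norm_mul, RCLike.norm_conj] using
      Complex.re_le_norm ((starRingEnd ℂ) x * (a * y))
  calc 2 * (K * (ε₁ * ((starRingEnd ℂ) x * (a * y)).re))
      ≤ 2 * (K * (ε₁ * (‖x‖ * (‖a‖ * ‖y‖)))) := by gcongr
    _ ≤ √q * (ε₁ * R₁ * ‖x‖ ^ 2 + ε₂ * R₂ * ‖y‖ ^ 2) := by
        refine two_mul_le_sqrt_mul_add hq (by positivity) ?_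
        calc (K * (ε₁ * (‖x‖ * (‖a‖ * ‖y‖)))) ^ 2
            = ε₁ * ‖x‖ ^ 2 * ‖y‖ ^ 2 * (ε₁ * (K ^ 2 * ‖a‖ ^ 2)) := by ring
          _ ≤ ε₁ * ‖x‖ ^ 2 * ‖y‖ ^ 2 * (q * ε₂ * (R₂ * R₁)) :=
              mul_le_mul_of_nonneg_left h (by positivity)
          _ = q * (ε₁ * R₁ * ‖x‖ ^ 2 * (ε₂ * R₂ * ‖y‖ ^ 2)) := by ring

variable [DecidableEq ι] {A : ι → ι → ℂ} {s t : Finset ι} {K : ℕ} {ε : ι → ℝ} {q : ℝ}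

theorem sum_mul_re_conj_mul_sum_offDiagonal_le {R : ι → ℝ}
    (hrow : ∀ k ∈ s, (t.filter fun j => k ≠ j ∧ A k j ≠ 0).card ≤ K)
    (hcol : ∀ j ∈ t, (s.filter fun k => k ≠ j ∧ A k j ≠ 0).card ≤ K)
    (hε : ∀ k, 0 ≤ ε k) (hR : ∀ k, 0 ≤ R k) (hq : 0 ≤ q)
    (hcpl : ∀ k ∈ s, ∀ j ∈ t, k ≠ j → A k j ≠ 0 →
      ε k * (K ^ 2 * ‖A k j‖ ^ 2) ≤ q * ε j * (R j * R k)) (e : ι → ℂ) :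
    ∑ k ∈ s, ε k * ((starRingEnd ℂ) (e k) * ∑ j ∈ t with k ≠ j ∧ A k j ≠ 0, A k j * e j).re ≤
      √q / 2 * (∑ k ∈ s, ε k * R k * ‖e k‖ ^ 2 + ∑ j ∈ t, ε j * R j * ‖e j‖ ^ 2) := by
  set w : ι → ℝ := fun k => ε k * R k * ‖e k‖ ^ 2
  have w_nonneg : ∀ k, 0 ≤ w k := fun k => mul_nonneg (mul_nonneg (hε k) (hR k)) (sq_nonneg _)
  rcases K.eq_zero_or_pos with rfl | hK
  · rw [Finset.sum_eq_zero fun k hk => by simp [Finset.card_eq_zero.1 (Nat.le_zero.1 (hrow k hk))]]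
    exact mul_nonneg (by positivity) (add_nonneg (Finset.sum_nonneg fun k _ => w_nonneg k)
      (Finset.sum_nonneg fun j _ => w_nonneg j))
  refine le_of_mul_le_mul_left ?_ (by positivity : (0 : ℝ) < 2 * K)
  calc 2 * K * ∑ k ∈ s,
        ε k * ((starRingEnd ℂ) (e k) * ∑ j ∈ t with k ≠ j ∧ A k j ≠ 0, A k j * e j).re
      = ∑ k ∈ s, ∑ j ∈ t with k ≠ j ∧ A k j ≠ 0,
          2 * (K * (ε k * ((starRingEnd ℂ) (e k) * (A k j * e j)).re)) := by
        simp_rw [Finset.mul_sum, Complex.re_sum, Finset.mul_sum, mul_assoc]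
    _ ≤ ∑ k ∈ s, ∑ j ∈ t with k ≠ j ∧ A k j ≠ 0, √q * (w k + w j) := by
        refine Finset.sum_le_sum fun k hk => Finset.sum_le_sum fun j hj => ?_
        obtain ⟨hjt, hkj, hne⟩ := Finset.mem_filter.1 hj
        exact two_mul_re_conj_mul_le K.cast_nonneg hq (hε k) (hε j) (hR k) (hR j)
          (hcpl k hk j hjt hkj hne)
    _ ≤ √q * (K * (∑ k ∈ s, w k + ∑ j ∈ t, w j)) := by
        simp_rw [← Finset.mul_sum]
        exact mul_le_mul_of_nonneg_left (sum_sum_filter_add_le hrow hcol (fun k _ => w_nonneg k)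
          fun j _ => w_nonneg j) (Real.sqrt_nonneg q)
    _ = 2 * K * (√q / 2 * (∑ k ∈ s, w k + ∑ j ∈ t, w j)) := by ring

theorem sum_mul_re_conj_mul_sum_le (hst : s ⊆ t)
    (hrow : ∀ k ∈ s, (t.filter fun j => k ≠ j ∧ A k j ≠ 0).card ≤ K)
    (hcol : ∀ j ∈ t, (s.filter fun k => k ≠ j ∧ A k j ≠ 0).card ≤ K)
    (hdiag : ∀ k ∈ s, (A k k).re ≤ 0) (hε : ∀ k, 0 ≤ ε k) (hq : 0 ≤ q)
    (hcpl : ∀ k ∈ s, ∀ j ∈ t, k ≠ j → A k j ≠ 0 →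
      ε k * (K ^ 2 * ‖A k j‖ ^ 2) ≤ q * ε j * (|(A j j).re| * |(A k k).re|)) (e : ι → ℂ) :
    ∑ k ∈ s, ε k * ((starRingEnd ℂ) (e k) * ∑ j ∈ t, A k j * e j).re ≤
      -∑ k ∈ s, ε k * |(A k k).re| * ‖e k‖ ^ 2 +
        √q / 2 * (∑ k ∈ s, ε k * |(A k k).re| * ‖e k‖ ^ 2 +
          ∑ j ∈ t, ε j * |(A j j).re| * ‖e j‖ ^ 2) := by
  have diagonal_split : ∀ k ∈ s, ε k * ((starRingEnd ℂ) (e k) * ∑ j ∈ t, A k j * e j).re =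
      -(ε k * |(A k k).re| * ‖e k‖ ^ 2) +
        ε k * ((starRingEnd ℂ) (e k) * ∑ j ∈ t with k ≠ j ∧ A k j ≠ 0, A k j * e j).re := by
    intro k hk
    have row_split : ∑ j ∈ t, A k j * e j =
        A k k * e k + ∑ j ∈ t with k ≠ j ∧ A k j ≠ 0, A k j * e j := by
      rw [← Finset.add_sum_erase _ _ (hst hk)]
      congr 1
      refine (Finset.sum_subset (fun j hj => ?_) fun j hj hj' => ?_).symm
      · grind
      · have : A k j = 0 := by grind
        rw [this, zero_mul]
    have diagonal : ((starRingEnd ℂ) (e k) * (A k k * e k)).re = (A k k).re * ‖e k‖ ^ 2 := by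
      rw [mul_left_comm, Complex.conj_mul', ← Complex.ofReal_pow, Complex.re_mul_ofReal]
    rw [row_split, mul_add, Complex.add_re, diagonal, abs_of_nonpos (hdiag k hk)]
    ring
  rw [Finset.sum_congr rfl diagonal_split, Finset.sum_add_distrib, Finset.sum_neg_distrib]
  gcongr
  exact sum_mul_re_conj_mul_sum_offDiagonal_le hrow hcol hε (fun k => abs_nonneg _) hq hcpl e

end WeightedSums

section Weights

theorem exists_bounded_weights {ι : Type*} [Finite ι] (ρ : ι → ℕ → ℕ → ℝ) {q : ℝ} (hq : 0 < q)
    {J : ℕ} (hJ : ∀ i j k, J ≤ j → 1 ≤ k → k < j → ρ i j k ≤ q) :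
    ∃ (ε : ℕ → ℝ) (E : ℝ), (∀ k, 1 ≤ ε k) ∧ (∀ k, ε k ≤ E) ∧
      ∀ i j k, 1 ≤ k → k < j → ε k * ρ i j k ≤ q * ε j := by
  obtain ⟨B, hB⟩ := (Set.finite_range fun p : ι × Fin J × Fin J =>
    ρ p.1 p.2.1 p.2.2 / q).bddAbove
  set b := max 1 B
  have one_le_b : 1 ≤ b := le_max_left _ _
  -- Geometric growth absorbs the finitely many couplings below `J`; it has to stop there for the
  -- weights to remain bounded.
  refine ⟨fun k => b ^ min k J, b ^ J, fun k => one_le_pow₀ one_le_b,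
    fun k => pow_le_pow_right₀ one_le_b (min_le_right _ _), fun i j k hk hkj => ?_⟩
  rcases le_or_gt J j with hj | hj
  · calc b ^ min k J * ρ i j k ≤ b ^ min k J * q := by
          gcongr
          exact hJ i j k hj hk hkj
      _ ≤ q * b ^ min j J := by
          rw [mul_comm]
          gcongr
  · have hρ : ρ i j k ≤ q * b := by
      have : ρ i j k / q ≤ b :=
        (hB ⟨(i, ⟨j, hj⟩, ⟨k, hkj.trans hj⟩), rfl⟩).trans (le_max_right _ _)
      rwa [div_le_iff₀' hq] at this
    calc b ^ min k J * ρ i j k ≤ b ^ min k J * (q * b) := by gcongr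
      _ = q * b ^ (min k J + 1) := by ring
      _ ≤ q * b ^ min j J := by
          gcongr
          omega

end Weights

section MonomialSums

theorem sum_pow_degree_le {σ : Type*} [Fintype σ] {s : ℝ} (h0 : 0 ≤ s) (h1 : s < 1)
    (S : Finset (σ →₀ ℕ)) : ∑ β ∈ S, s ^ β.degree ≤ ((1 - s)⁻¹) ^ Fintype.card σ := by
  classical
  set D := S.sup fun β => β.degree
  have subset_box : S.map Finsupp.equivFunOnFinite.toEmbedding ⊆
      Fintype.piFinset fun _ => Finset.range (D + 1) := by
    intro v hv
    obtain ⟨β, hβ, rfl⟩ := Finset.mem_map.1 hv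
    refine Fintype.mem_piFinset.2 fun l => Finset.mem_range_succ_iff.2 ?_
    exact (Finsupp.le_degree l β).trans (Finset.le_sup (f := fun β : σ →₀ ℕ => β.degree) hβ)
  calc ∑ β ∈ S, s ^ β.degree
      = ∑ v ∈ S.map Finsupp.equivFunOnFinite.toEmbedding, ∏ l, s ^ v l := by
        rw [Finset.sum_map]
        refine Finset.sum_congr rfl fun β _ => ?_
        rw [Finset.prod_pow_eq_pow_sum, Finsupp.degree_eq_sum]
        rfl
    _ ≤ ∑ v ∈ Fintype.piFinset fun _ => Finset.range (D + 1), ∏ l, s ^ v l :=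
        Finset.sum_le_sum_of_subset_of_nonneg subset_box fun v _ _ =>
          Finset.prod_nonneg fun l _ => pow_nonneg h0 _
    _ = (∑ a ∈ Finset.range (D + 1), s ^ a) ^ Fintype.card σ := by
        rw [Finset.sum_prod_piFinset (Finset.range (D + 1)) fun _ a => s ^ a]
        simp
    _ ≤ ((1 - s)⁻¹) ^ Fintype.card σ := by
        gcongr
        rw [← tsum_geometric_of_lt_one h0 h1]
        exact (summable_geometric_of_lt_one h0 h1).sum_le_tsum _ fun _ _ => pow_nonneg h0 _

theorem summable_degree_mul_pow_degree {σ : Type*} [Finite σ] {s : ℝ} (h0 : 0 ≤ s) (h1 : s < 1) :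
    Summable fun β : σ →₀ ℕ => (β.degree : ℝ) * s ^ β.degree := by
  have := Fintype.ofFinite σ
  have sqrt_nonneg : 0 ≤ √s := Real.sqrt_nonneg s
  have sqrt_lt_one : √s < 1 := by rwa [Real.sqrt_lt' one_pos, one_pow]
  have summable_pow : Summable fun β : σ →₀ ℕ => √s ^ β.degree :=
    summable_of_sum_le (fun _ => pow_nonneg sqrt_nonneg _)
      (sum_pow_degree_le sqrt_nonneg sqrt_lt_one)
  obtain ⟨B, hB⟩ := (tendsto_self_mul_const_pow_of_lt_one
    sqrt_nonneg sqrt_lt_one).bddAbove_range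
  refine .of_nonneg_of_le (fun β => by positivity) (fun β => ?_) (summable_pow.mul_left B)
  calc (β.degree : ℝ) * s ^ β.degree = (β.degree * √s ^ β.degree) * √s ^ β.degree := by
        rw [mul_assoc, ← mul_pow, Real.mul_self_sqrt h0]
    _ ≤ B * √s ^ β.degree := by
        gcongr
        exact hB ⟨β.degree, rfl⟩

variable {n : ℕ} [NeZero n]

theorem norm_monomialFun_le (k : ℕ) (z : Fin n → ℂ) :
    ‖monomialFun k z‖ ≤ ‖z‖ ^ (multiIndex n k).degree := by
  rw [monomialFun, norm_prod, Finsupp.degree_eq_sum, ← Finset.prod_pow_eq_pow_sum]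
  simp_rw [norm_pow]
  exact Finset.prod_le_prod (fun _ _ => by positivity) fun l _ =>
    pow_le_pow_left₀ (norm_nonneg _) (norm_le_pi_norm z l) _

theorem norm_monomialFun_sq_le (k : ℕ) (z : Fin n → ℂ) :
    ‖monomialFun k z‖ ^ 2 ≤ (‖z‖ ^ 2) ^ (multiIndex n k).degree := by
  rw [← pow_mul, mul_comm, pow_mul]
  exact pow_le_pow_left₀ (norm_nonneg _) (norm_monomialFun_le k z) 2

theorem sum_Ico_pow_degree_multiIndex_le {s : ℝ} (h0 : 0 ≤ s) (h1 : s < 1) (N : ℕ) :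
    ∑ k ∈ Finset.Ico 1 N, s ^ (multiIndex n k).degree ≤ ((1 - s)⁻¹) ^ n - 1 := by
  have h := sum_pow_degree_le h0 h1
    ((insert 0 (Finset.Ico 1 N)).map (multiIndex n).toEmbedding)
  rw [Finset.sum_map, Finset.sum_insert (by simp), Fintype.card_fin] at h
  simp only [Equiv.coe_toEmbedding, multiIndex_zero, map_zero, pow_zero] at h
  linarith

end MonomialSums

section Lyapunov

theorem eventually_sum_range_le_sum_range_add {b : ℕ → ℝ} (hb : Summable b) {η : ℝ} (hη : 0 < η) :
    ∀ᶠ N in atTop, ∀ a : ℕ → ℝ, (∀ k, 0 ≤ a k) → (∀ k, a k ≤ b k) → ∀ M,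
      ∑ k ∈ Finset.range M, a k ≤ ∑ k ∈ Finset.range N, a k + η := by
  filter_upwards [(tendsto_sum_nat_add b).eventually_lt_const hη] with N hN a ha hab M
  have summable_a : Summable a := .of_nonneg_of_le ha hab hb
  calc ∑ k ∈ Finset.range M, a k ≤ ∑' k, a k := summable_a.sum_le_tsum _ fun k _ => ha k
    _ = ∑ k ∈ Finset.range N, a k + ∑' k, a (k + N) := (summable_a.sum_add_tsum_nat_add N).symm
    _ ≤ ∑ k ∈ Finset.range N, a k + ∑' k, b (k + N) := by
        gcongr
        · exact (summable_nat_add_iff N).2 summable_a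
        · exact (summable_nat_add_iff N).2 hb
        · exact hab _
    _ ≤ ∑ k ∈ Finset.range N, a k + η := by gcongr

variable {n : ℕ} [NeZero n]

/-- The truncation `∑_{1 ≤ k < N} ε_k |e_k|²` of the Lyapunov function of a triangular Koopman
system. -/
def lyapunovSum (ε : ℕ → ℝ) (N : ℕ) (z : Fin n → ℂ) : ℝ :=
  ∑ k ∈ Finset.Ico 1 N, ε k * ‖monomialFun k z‖ ^ 2

theorem lyapunovSum_le {E : ℝ} {ε : ℕ → ℝ} (hε : ∀ k, 0 ≤ ε k) (hεE : ∀ k, ε k ≤ E)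
    {z : Fin n → ℂ} (hz : ‖z‖ < 1) (N : ℕ) :
    lyapunovSum ε N z ≤ E * (((1 - ‖z‖ ^ 2)⁻¹) ^ n - 1) := by
  have hE : 0 ≤ E := (hε 0).trans (hεE 0)
  calc lyapunovSum ε N z
      ≤ ∑ k ∈ Finset.Ico 1 N, E * (‖z‖ ^ 2) ^ (multiIndex n k).degree :=
        Finset.sum_le_sum fun k _ =>
          mul_le_mul (hεE k) (norm_monomialFun_sq_le k z) (sq_nonneg _) hE
    _ = E * ∑ k ∈ Finset.Ico 1 N, (‖z‖ ^ 2) ^ (multiIndex n k).degree := by rw [Finset.mul_sum]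
    _ ≤ E * (((1 - ‖z‖ ^ 2)⁻¹) ^ n - 1) := by
        gcongr
        exact sum_Ico_pow_degree_multiIndex_le (sq_nonneg _)
          (pow_lt_one₀ (norm_nonneg z) hz two_ne_zero) N

theorem exists_monomialFun_eq_apply (l : Fin n) : ∃ k ≠ 0, ∀ z, monomialFun k z = z l := by
  obtain ⟨k, hk⟩ := (multiIndex n).surjective (Finsupp.single l 1)
  refine ⟨k, ?_, fun z => by simp [monomialFun, hk, Finsupp.single_apply]⟩
  rintro rfl
  rw [multiIndex_zero] at hk
  exact one_ne_zero (Finsupp.single_eq_zero.1 hk.symm)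

theorem eventually_norm_sq_le_lyapunovSum {ε : ℕ → ℝ} (hε : ∀ k, 1 ≤ ε k) :
    ∀ᶠ N in atTop, ∀ z : Fin n → ℂ, ‖z‖ ^ 2 ≤ lyapunovSum ε N z := by
  choose k hk hkl using exists_monomialFun_eq_apply (n := n)
  filter_upwards [eventually_all.2 fun l => eventually_gt_atTop (k l)] with N hN z
  obtain ⟨l, hl⟩ := Finite.exists_max fun l => ‖z l‖
  have norm_z : ‖z‖ ≤ ‖z l‖ := (pi_norm_le_iff_of_nonneg (norm_nonneg _)).2 hl
  calc ‖z‖ ^ 2 ≤ 1 * ‖monomialFun (k l) z‖ ^ 2 := by rw [one_mul, hkl]; gcongr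
    _ ≤ ε (k l) * ‖monomialFun (k l) z‖ ^ 2 := by gcongr; exact hε _
    _ ≤ lyapunovSum ε N z :=
        Finset.single_le_sum (f := fun k => ε k * ‖monomialFun k z‖ ^ 2)
          (fun k _ => mul_nonneg (zero_le_one.trans (hε k)) (sq_nonneg _))
          (Finset.mem_Ico.2 ⟨Nat.one_le_iff_ne_zero.2 (hk l), hN l⟩)

theorem hasFDerivAt_lyapunovSum (ε : ℕ → ℝ) (N : ℕ) (z : Fin n → ℂ) :
    HasFDerivAt (lyapunovSum ε N) (∑ k ∈ Finset.Ico 1 N, ε k • 2 •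
      (innerSL ℝ (monomialFun k z)).comp ((fderiv ℂ (monomialFun k) z).restrictScalars ℝ)) z :=
  .fun_sum fun k _ =>
    ((differentiable_monomialFun k z).hasFDerivAt.restrictScalars ℝ).norm_sq.const_mul (ε k)

theorem fderiv_lyapunovSum_apply (ε : ℕ → ℝ) (N : ℕ) (G : (Fin n → ℂ) → Fin n → ℂ)
    (z : Fin n → ℂ) :
    fderiv ℝ (lyapunovSum ε N) z (G z) = 2 * ∑ k ∈ Finset.Ico 1 N,
      ε k * ((starRingEnd ℂ) (monomialFun k z) * koopmanGenerator G (monomialFun k) z).re := by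
  rw [(hasFDerivAt_lyapunovSum ε N z).fderiv, sum_apply, Finset.mul_sum]
  refine Finset.sum_congr rfl fun k _ => ?_
  simp [koopmanGenerator, Complex.inner]
  ring

/-- A vector field that vanishes at the origin and whose linear part is upper triangular with
diagonal entries of real part at most `-c`. -/
structure IsTriangularStable (c : ℝ) (F : Fin n → MvPolynomial (Fin n) ℂ) : Prop where
  zero : polyField F 0 = 0
  upper : (jacobianZero F).IsUpperTriangular
  diag : ∀ l, (jacobianZero F l l).re ≤ -c

variable {c q : ℝ} {F : Fin n → MvPolynomial (Fin n) ℂ} {ε : ℕ → ℝ}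

theorem IsTriangularStable.re_koopmanEntry_self_le (hF : IsTriangularStable c F) (hc : 0 ≤ c)
    {k : ℕ} (hk : k ≠ 0) : (koopmanEntry (polyField F) k k).re ≤ -c := by
  rw [koopmanEntry_self, Complex.re_sum]
  calc ∑ l, ((multiIndex n k l : ℂ) * jacobianZero F l l).re
      ≤ ∑ l, (multiIndex n k l : ℝ) * -c := by
        refine Finset.sum_le_sum fun l _ => ?_
        rw [← Complex.ofReal_natCast, Complex.re_ofReal_mul]
        exact mul_le_mul_of_nonneg_left (hF.diag l) (Nat.cast_nonneg _)
    _ = -((multiIndex n k).degree * c) := by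
        rw [← Finset.sum_mul, Finsupp.degree_eq_sum, Nat.cast_sum, mul_neg]
    _ ≤ -c := neg_le_neg (le_mul_of_one_le_left hc (Nat.one_le_cast.2 (degree_multiIndex_pos hk)))

theorem IsTriangularStable.le_abs_re_koopmanEntry_self (hF : IsTriangularStable c F) (hc : 0 ≤ c)
    {k : ℕ} (hk : k ≠ 0) : c ≤ |(koopmanEntry (polyField F) k k).re| :=
  (le_neg.2 (hF.re_koopmanEntry_self_le hc hk)).trans (neg_le_abs _)

theorem abs_re_koopmanEntry_self_le (F : Fin n → MvPolynomial (Fin n) ℂ) (k : ℕ) :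
    |(koopmanEntry (polyField F) k k).re| ≤
      (∑ l, ‖jacobianZero F l l‖) * (multiIndex n k).degree := by
  refine (Complex.abs_re_le_norm _).trans ?_
  rw [koopmanEntry_self, Finset.sum_mul]
  refine (norm_sum_le _ _).trans (Finset.sum_le_sum fun l _ => ?_)
  rw [norm_mul, Complex.norm_natCast, mul_comm]
  gcongr
  exact Finsupp.le_degree l _

/-- The contribution `ε_k |Re ⟨L_F e_k, e_k⟩| |e_k(z)|²` of the `k`-th diagonal entry of the Koopman
matrix to the decay rate of the Lyapunov function. -/
def dissipation (F : Fin n → MvPolynomial (Fin n) ℂ) (ε : ℕ → ℝ) (k : ℕ) (z : Fin n → ℂ) : ℝ :=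
  ε k * |(koopmanEntry (polyField F) k k).re| * ‖monomialFun k z‖ ^ 2

theorem dissipation_nonneg (hε : ∀ k, 0 ≤ ε k) (k : ℕ) (z : Fin n → ℂ) :
    0 ≤ dissipation F ε k z :=
  mul_nonneg (mul_nonneg (hε k) (abs_nonneg _)) (sq_nonneg _)

theorem sum_Ico_one_dissipation (F : Fin n → MvPolynomial (Fin n) ℂ) (ε : ℕ → ℝ) (N : ℕ)
    (z : Fin n → ℂ) :
    ∑ k ∈ Finset.Ico 1 N, dissipation F ε k z = ∑ k ∈ Finset.range N, dissipation F ε k z := by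
  rcases N.eq_zero_or_pos with rfl | hN
  · rfl
  · rw [Finset.sum_range_eq_add_Ico _ hN, right_eq_add]
    simp [dissipation, koopmanEntry_self, multiIndex_zero]

theorem IsTriangularStable.mul_lyapunovSum_le (hF : IsTriangularStable c F) (hc : 0 ≤ c)
    (hε : ∀ k, 0 ≤ ε k) (N : ℕ) (z : Fin n → ℂ) :
    c * lyapunovSum ε N z ≤ ∑ k ∈ Finset.range N, dissipation F ε k z := by
  rw [← sum_Ico_one_dissipation, lyapunovSum, Finset.mul_sum]
  refine Finset.sum_le_sum fun k hk => ?_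
  rw [mul_left_comm, dissipation, mul_assoc]
  have hk0 : k ≠ 0 := Nat.one_le_iff_ne_zero.1 (Finset.mem_Ico.1 hk).1
  gcongr
  · exact hε k
  · exact hF.le_abs_re_koopmanEntry_self hc hk0

theorem eventually_sum_range_dissipation_le {E r η : ℝ} (F : Fin n → MvPolynomial (Fin n) ℂ)
    (hε : ∀ k, 0 ≤ ε k) (hεE : ∀ k, ε k ≤ E) (hr0 : 0 ≤ r) (hr1 : r < 1) (hη : 0 < η) :
    ∀ᶠ N in atTop, ∀ (M : ℕ) (z : Fin n → ℂ), ‖z‖ ≤ r →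
      ∑ k ∈ Finset.range M, dissipation F ε k z ≤
        ∑ k ∈ Finset.range N, dissipation F ε k z + η := by
  set C := ∑ l, ‖jacobianZero F l l‖
  have : 0 ≤ C := Finset.sum_nonneg fun l _ => norm_nonneg _
  have hE : 0 ≤ E := (hε 0).trans (hεE 0)
  have summable_bound : Summable fun k =>
      E * C * ((multiIndex n k).degree * (r ^ 2) ^ (multiIndex n k).degree) :=
    (((multiIndex n).summable_iff.2 (summable_degree_mul_pow_degree (sq_nonneg r)
      (pow_lt_one₀ hr0 hr1 two_ne_zero))).mul_left _)
  filter_upwards [eventually_sum_range_le_sum_range_add summable_bound hη] with N hN M z hz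
  refine hN _ (fun k => dissipation_nonneg hε k z) (fun k => ?_) M
  calc dissipation F ε k z
      ≤ E * (C * (multiIndex n k).degree) * (r ^ 2) ^ (multiIndex n k).degree := by
        rw [dissipation]
        gcongr
        · exact hεE k
        · exact abs_re_koopmanEntry_self_le F k
        · exact (norm_monomialFun_sq_le k z).trans (pow_le_pow_left₀ (sq_nonneg _)
            (pow_le_pow_left₀ (norm_nonneg z) hz 2) _)
    _ = E * C * ((multiIndex n k).degree * (r ^ 2) ^ (multiIndex n k).degree) := by ring

theorem IsTriangularStable.mul_norm_koopmanEntry_sq_le (hF : IsTriangularStable c F) (hc : 0 < c)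
    (hcpl : ∀ j k, 1 ≤ k → k < j → ε k * couplingRatio F j k ≤ q * ε j) {j k : ℕ} (hk : 1 ≤ k)
    (hkj : k < j) :
    ε k * (numTerms F ^ 2 * ‖koopmanEntry (polyField F) k j‖ ^ 2) ≤
      q * ε j * (|(koopmanEntry (polyField F) j j).re| *
        |(koopmanEntry (polyField F) k k).re|) := by
  have abs_pos : ∀ i, 1 ≤ i → 0 < |(koopmanEntry (polyField F) i i).re| := fun i hi =>
    hc.trans_le (hF.le_abs_re_koopmanEntry_self hc.le (Nat.one_le_iff_ne_zero.1 hi))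
  have h := hcpl j k hk hkj
  rwa [couplingRatio, ← mul_div_assoc,
    div_le_iff₀ (mul_pos (abs_pos j (hk.trans hkj.le)) (abs_pos k hk))] at h

theorem IsTriangularStable.eventually_fderiv_lyapunovSum_le_sum_dissipation
    (hF : IsTriangularStable c F) (hc : 0 < c) (hq : 0 ≤ q) (hε : ∀ k, 0 ≤ ε k)
    (hcpl : ∀ j k, 1 ≤ k → k < j → ε k * couplingRatio F j k ≤ q * ε j) (N : ℕ) :
    ∀ᶠ M in atTop, ∀ z, fderiv ℝ (lyapunovSum ε N) z (polyField F z) ≤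
      -(2 * ∑ k ∈ Finset.range N, dissipation F ε k z) +
        √q * (∑ k ∈ Finset.range N, dissipation F ε k z +
          ∑ k ∈ Finset.range M, dissipation F ε k z) := by
  filter_upwards [eventually_ge_atTop N, (Finset.eventually_all (Finset.Ico 1 N)).2 fun k _ =>
    eventually_koopmanGenerator_monomialFun_eq_sum F k] with M hNM hM z
  have one_le_left : ∀ {k}, k ∈ Finset.Ico 1 N → 1 ≤ k := fun hk => (Finset.mem_Ico.1 hk).1
  have bound := sum_mul_re_conj_mul_sum_le (A := koopmanEntry (polyField F)) (q := q)
    (s := Finset.Ico 1 N) (t := Finset.range M)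
    (fun k hk => Finset.mem_range.2 ((Finset.mem_Ico.1 hk).2.trans_le hNM))
    (fun k _ => card_koopmanEntry_row_le F k _) (fun j _ => card_koopmanEntry_column_le F j _)
    (fun k hk => (hF.re_koopmanEntry_self_le hc.le
      (Nat.one_le_iff_ne_zero.1 (one_le_left hk))).trans (neg_nonpos.2 hc.le)) hε hq
    (fun k hk j _ hkj hne => hF.mul_norm_koopmanEntry_sq_le hc hcpl (one_le_left hk)
      ((le_of_koopmanEntry_ne_zero hF.zero hF.upper hne).lt_of_ne hkj))
    (fun k => monomialFun k z)
  rw [fderiv_lyapunovSum_apply, Finset.sum_congr rfl fun k hk => by rw [hM k hk z],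
    ← sum_Ico_one_dissipation]
  simp only [dissipation] at bound ⊢
  linarith

theorem IsTriangularStable.eventually_fderiv_lyapunovSum_le {E r η : ℝ}
    (hF : IsTriangularStable c F) (hc : 0 < c) (hq0 : 0 ≤ q) (hq1 : q ≤ 1) (hε : ∀ k, 0 ≤ ε k)
    (hεE : ∀ k, ε k ≤ E) (hcpl : ∀ j k, 1 ≤ k → k < j → ε k * couplingRatio F j k ≤ q * ε j)
    (hr0 : 0 ≤ r) (hr1 : r < 1) (hη : 0 < η) :
    ∀ᶠ N in atTop, ∀ z : Fin n → ℂ, ‖z‖ ≤ r →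
      fderiv ℝ (lyapunovSum ε N) z (polyField F z) ≤
        -(2 * (1 - √q) * c) * lyapunovSum ε N z + η := by
  filter_upwards [eventually_sum_range_dissipation_le F hε hεE hr0 hr1 hη] with N hN z hz
  obtain ⟨M, hM⟩ :=
    (hF.eventually_fderiv_lyapunovSum_le_sum_dissipation hc hq0 hε hcpl N).exists
  have sqrt_le_one : √q ≤ 1 := Real.sqrt_le_one.2 hq1
  set D := ∑ k ∈ Finset.range N, dissipation F ε k z
  calc fderiv ℝ (lyapunovSum ε N) z (polyField F z)
      ≤ -(2 * D) + √q * (D + ∑ k ∈ Finset.range M, dissipation F ε k z) := hM z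
    _ ≤ -(2 * D) + √q * (D + (D + η)) := by gcongr; exact hN M z hz
    _ = -(2 * (1 - √q) * D) + √q * η := by ring
    _ ≤ -(2 * (1 - √q) * (c * lyapunovSum ε N z)) + 1 * η := by
        have : 0 ≤ 1 - √q := sub_nonneg.2 sqrt_le_one
        gcongr
        exact hF.mul_lyapunovSum_le hc.le hε N z
    _ = -(2 * (1 - √q) * c) * lyapunovSum ε N z + η := by ring

end Lyapunov

section SwitchedSystems

theorem tendsto_zero_of_norm_sq_le_exp {E : Type*} [NormedAddCommGroup E] {x : ℝ → E} {B κ : ℝ}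
    (hκ : 0 < κ) (h : ∀ t, 0 ≤ t → ‖x t‖ ^ 2 ≤ B * Real.exp (-κ * t)) :
    Tendsto x atTop (𝓝 0) := by
  have exp_tendsto : Tendsto (fun t => B * Real.exp (-κ * t)) atTop (𝓝 0) := by
    rw [← mul_zero B]
    exact (Real.tendsto_exp_atBot.comp
      (tendsto_id.const_mul_atTop_of_neg (neg_neg_of_pos hκ))).const_mul B
  have sq_tendsto : Tendsto (fun t => ‖x t‖ ^ 2) atTop (𝓝 0) :=
    squeeze_zero' (Eventually.of_forall fun t => sq_nonneg _)
      ((eventually_ge_atTop 0).mono h) exp_tendsto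
  have sqrt_tendsto := sq_tendsto.sqrt
  rw [Real.sqrt_zero] at sqrt_tendsto
  exact tendsto_zero_iff_norm_tendsto_zero.2
    (sqrt_tendsto.congr fun t => Real.sqrt_sq (norm_nonneg _))

variable {E : Type*} [NormedAddCommGroup E] [NormedSpace ℝ E] {ι : Type*}
  {F : ι → E → E} {σ : ℝ → ι} {a b c : ℝ} {x y : ℝ → E}

theorem eq_of_forall_isConstantNear (h : ∀ t ∈ Set.Ioo a b, IsConstantNear σ t) {s t : ℝ}
    (hs : s ∈ Set.Ioo a b) (ht : t ∈ Set.Ioo a b) : σ s = σ t := by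
  let _ : TopologicalSpace ι := ⊥
  have : DiscreteTopology ι := ⟨rfl⟩
  refine isPreconnected_Ioo.constant (fun u hu => ContinuousAt.continuousWithinAt ?_) hs ht
  exact tendsto_const_nhds.congr' ((h u hu).mono fun v hv => hv.symm)

theorem exists_eq_on_Ioo_of_forall_isConstantNear (hab : a < b)
    (h : ∀ t ∈ Set.Ioo a b, IsConstantNear σ t) : ∃ i, ∀ t ∈ Set.Ioo a b, σ t = i := by
  obtain ⟨s, hs⟩ := Set.nonempty_Ioo.2 hab
  exact ⟨σ s, fun t ht => eq_of_forall_isConstantNear h ht hs⟩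

theorem isConstantNear_of_forall_eq {i : ι} (h : ∀ t ∈ Set.Ioo a b, σ t = i) {t : ℝ}
    (ht : t ∈ Set.Ioo a b) : IsConstantNear σ t := by
  filter_upwards [Ioo_mem_nhds ht.1 ht.2] with s hs
  rw [h s hs, h t ht]

theorem IsCommutationLaw.exists_eventually_right_eq (hσ : IsCommutationLaw σ) {t : ℝ}
    (ht : 0 ≤ t) : ∃ i, ∀ᶠ s in 𝓝[>] t, σ s = i := by
  have no_switching : ∀ᶠ s in 𝓝[>] t,
      s ∉ {s : ℝ | 0 < s ∧ s ≤ t + 1 ∧ ¬ IsConstantNear σ s} \ {t} :=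
    nhdsWithin_le_nhds ((((hσ (t + 1)).subset Set.sdiff_subset).isClosed.isOpen_compl).mem_nhds
      (by simp))
  obtain ⟨u, htu, hu⟩ := mem_nhdsGT_iff_exists_Ioo_subset.1
    (no_switching.and (Ioo_mem_nhdsGT (lt_add_one t)))
  obtain ⟨i, hi⟩ := exists_eq_on_Ioo_of_forall_isConstantNear htu fun s hs => by
    obtain ⟨hns, hts, hst⟩ := hu hs
    by_contra hswitch
    exact hns ⟨⟨ht.trans_lt hts, hst.le, hswitch⟩, hts.ne'⟩
  exact ⟨i, mem_of_superset (Ioo_mem_nhdsGT htu) hi⟩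

theorem IsCommutationLaw.induction_on_intervals (hσ : IsCommutationLaw σ) {Q : ℝ → ℝ → Prop}
    (trans : ∀ a b c, 0 ≤ a → a < b → b < c → ¬ IsConstantNear σ b → Q a b → Q b c → Q a c)
    (const : ∀ a b i, a < b → (∀ t ∈ Set.Ioo a b, σ t = i) → Q a b)
    (ha : 0 ≤ a) (hab : a < b) : Q a b := by
  have finite_switching : ∀ a b, 0 ≤ a → {t | t ∈ Set.Ioo a b ∧ ¬ IsConstantNear σ t}.Finite :=
    fun a b ha => (hσ b).subset fun t ht => ⟨ha.trans_lt ht.1.1, ht.1.2.le, ht.2⟩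
  induction h : {t | t ∈ Set.Ioo a b ∧ ¬ IsConstantNear σ t}.ncard using Nat.strong_induction_on
    generalizing a b with
  | _ N ih =>
    subst h
    by_cases hconst : ∀ t ∈ Set.Ioo a b, IsConstantNear σ t
    · obtain ⟨i, hi⟩ := exists_eq_on_Ioo_of_forall_isConstantNear hab hconst
      exact const a b i hab hi
    · push Not at hconst
      obtain ⟨s, hs, hswitch⟩ := hconst
      refine trans a s b ha hs.1 hs.2 hswitch
        (ih _ (Set.ncard_lt_ncard ?_ (finite_switching a b ha)) ha hs.1 rfl)
        (ih _ (Set.ncard_lt_ncard ?_ (finite_switching a b ha)) (ha.trans hs.1.le) hs.2 rfl)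
      · exact ⟨fun t ht => ⟨⟨ht.1.1, ht.1.2.trans hs.2⟩, ht.2⟩,
          fun hsub => lt_irrefl s (hsub ⟨hs, hswitch⟩).1.2⟩
      · exact ⟨fun t ht => ⟨⟨hs.1.trans ht.1.1, ht.1.2⟩, ht.2⟩,
          fun hsub => lt_irrefl s (hsub ⟨hs, hswitch⟩).1.1⟩

/-- `x` is a trajectory of the switched system on `[a, b]`: it is continuous, and between the
switching times it solves the equation of the active subsystem. -/
def IsTrajectoryOn (F : ι → E → E) (σ : ℝ → ι) (a b : ℝ) (x : ℝ → E) : Prop :=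
  ContinuousOn x (Set.Icc a b) ∧
    ∀ t ∈ Set.Ioo a b, IsConstantNear σ t → HasDerivAt x (F (σ t) (x t)) t

theorem IsTrajectory.isTrajectoryOn (hx : IsTrajectory F σ x) (ha : 0 ≤ a) :
    IsTrajectoryOn F σ a b x :=
  ⟨hx.1.mono fun _ ht => ha.trans ht.1, fun t ht => hx.2 t (ha.trans_lt ht.1)⟩

theorem IsTrajectoryOn.mono (hx : IsTrajectoryOn F σ a c x) {a' c' : ℝ} (ha : a ≤ a')
    (hc : c' ≤ c) : IsTrajectoryOn F σ a' c' x :=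
  ⟨hx.1.mono (Set.Icc_subset_Icc ha hc), fun t ht => hx.2 t (Set.Ioo_subset_Ioo ha hc ht)⟩

theorem IsTrajectoryOn.concat (hab : a ≤ b) (hbc : b ≤ c) (hb : ¬ IsConstantNear σ b)
    (hx : IsTrajectoryOn F σ a b x) (hy : IsTrajectoryOn F σ b c y) (h : x b = y b) :
    IsTrajectoryOn F σ a c fun t => if t ≤ b then x t else y t := by
  constructor
  · rw [← Set.Icc_union_Icc_eq_Icc hab hbc]
    refine ContinuousOn.union_of_isClosed (hx.1.congr fun t ht => if_pos ht.2)
      (hy.1.congr fun t ht => ?_) isClosed_Icc isClosed_Icc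
    rcases ht.1.eq_or_lt with rfl | hbt
    · simpa using h
    · exact if_neg (not_le.2 hbt)
  · intro t ht hσt
    rcases lt_trichotomy t b with htb | rfl | hbt
    · beta_reduce
      rw [if_pos htb.le]
      refine (hx.2 t ⟨ht.1, htb⟩ hσt).congr_of_eventuallyEq ?_
      filter_upwards [Iio_mem_nhds htb] with s hs
      exact if_pos (le_of_lt hs)
    · exact absurd hσt hb
    · beta_reduce
      rw [if_neg (not_le.2 hbt)]
      refine (hy.2 t ⟨hbt, ht.2⟩ hσt).congr_of_eventuallyEq ?_
      filter_upwards [Ioi_mem_nhds hbt] with s hs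
      exact if_neg (not_le.2 hs)

theorem IsSolution.isTrajectoryOn {i : ι} (hy : IsSolution (F i) y)
    (hσ : ∀ t ∈ Set.Ioo a b, σ t = i) : IsTrajectoryOn F σ a b fun t => y (t - a) := by
  constructor
  · have continuousOn_y : ContinuousOn y (Set.Ici 0) := fun t ht => (hy t ht).continuousWithinAt
    exact continuousOn_y.comp (by fun_prop) fun t ht => sub_nonneg.2 ht.1
  · intro t ht _
    have hat : 0 < t - a := sub_pos.2 ht.1
    rw [hσ t ht]
    exact ((hy (t - a) hat.le).hasDerivAt (Ici_mem_nhds hat)).comp_sub_const t a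

theorem IsTrajectoryOn.hasDerivWithinAt_Ici (hx : IsTrajectoryOn F σ a b x) {i : ι}
    (hF : Continuous (F i)) {t : ℝ} (hat : a ≤ t) (htb : t < b) (hσ : ∀ᶠ s in 𝓝[>] t, σ s = i) :
    HasDerivWithinAt x (F i (x t)) (Set.Ici t) t := by
  obtain ⟨u, htu, hu⟩ := mem_nhdsGT_iff_exists_Ioo_subset.1 (hσ.and (Ioo_mem_nhdsGT htb))
  have hderiv : ∀ s ∈ Set.Ioo t u, HasDerivAt x (F i (x s)) s := fun s hs => by
    have := hx.2 s ⟨hat.trans_lt hs.1, (hu hs).2.2⟩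
      (isConstantNear_of_forall_eq (fun v hv => (hu hv).1) hs)
    rwa [(hu hs).1] at this
  have hcont : ContinuousWithinAt x (Set.Ioo t u) t :=
    (hx.1 t ⟨hat, htb.le⟩).mono fun s hs => ⟨hat.trans hs.1.le, (hu hs).2.2.le⟩
  refine hasDerivWithinAt_Ici_of_tendsto_deriv
    (fun s hs => (hderiv s hs).differentiableAt.differentiableWithinAt) hcont
    (Ioo_mem_nhdsGT htu) ?_
  rw [← nhdsWithin_Ioo_eq_nhdsGT htu]
  refine ((hF.tendsto _).comp hcont).congr' ?_
  filter_upwards [self_mem_nhdsWithin] with s hs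
  exact (hderiv s hs).deriv.symm

theorem IsTrajectoryOn.eqOn_of_const {i : ι} (hF : LocallyLipschitz (F i))
    (hσ : ∀ t ∈ Set.Ioo a b, σ t = i) (hx : IsTrajectoryOn F σ a b x)
    (hy : IsTrajectoryOn F σ a b y) (h : x a = y a) : Set.EqOn x y (Set.Icc a b) := by
  obtain ⟨K, hLip⟩ := hF.locallyLipschitzOn.exists_lipschitzOnWith_of_compact
    ((isCompact_Icc.image_of_continuousOn hx.1).union (isCompact_Icc.image_of_continuousOn hy.1))
  have right_eq : ∀ t ∈ Set.Ico a b, ∀ᶠ s in 𝓝[>] t, σ s = i := fun t ht =>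
    mem_of_superset (Ioo_mem_nhdsGT ht.2) fun s hs => hσ s ⟨ht.1.trans_lt hs.1, hs.2⟩
  exact ODE_solution_unique_of_mem_Icc_right (v := fun _ => F i) (fun t _ => hLip) hx.1
    (fun t ht => hx.hasDerivWithinAt_Ici hF.continuous ht.1 ht.2 (right_eq t ht))
    (fun t ht => Or.inl ⟨t, Set.Ico_subset_Icc_self ht, rfl⟩) hy.1
    (fun t ht => hy.hasDerivWithinAt_Ici hF.continuous ht.1 ht.2 (right_eq t ht))
    (fun t ht => Or.inr ⟨t, Set.Ico_subset_Icc_self ht, rfl⟩) h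

theorem IsTrajectoryOn.eqOn (hF : ∀ i, LocallyLipschitz (F i)) (hσ : IsCommutationLaw σ)
    (ha : 0 ≤ a) (hab : a < b) (hx : IsTrajectoryOn F σ a b x) (hy : IsTrajectoryOn F σ a b y)
    (h : x a = y a) : Set.EqOn x y (Set.Icc a b) := by
  refine hσ.induction_on_intervals (Q := fun a b => IsTrajectoryOn F σ a b x →
    IsTrajectoryOn F σ a b y → x a = y a → Set.EqOn x y (Set.Icc a b))
    (fun a b c _ hab hbc _ eqOn_left eqOn_right hx hy h => ?_)
    (fun a b i _ hi hx hy h => hx.eqOn_of_const (hF i) hi hy h) ha hab hx hy h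
  have eq_left := eqOn_left (hx.mono le_rfl hbc.le) (hy.mono le_rfl hbc.le) h
  rw [← Set.Icc_union_Icc_eq_Icc hab.le hbc.le]
  exact eq_left.union (eqOn_right (hx.mono hab.le le_rfl) (hy.mono hab.le le_rfl)
    (eq_left ⟨hab.le, le_rfl⟩))

/-- `D` is viable for `f`: from every point of `D` starts a solution on `[0, ∞)` that stays in `D`.
For uniquely solvable equations this is completeness together with forward invariance. -/
def IsViable (f : E → E) (D : Set E) : Prop :=
  ∀ x₀ ∈ D, ∃ x : ℝ → E, IsSolution f x ∧ x 0 = x₀ ∧ ∀ t, 0 ≤ t → x t ∈ D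

variable {D : Set E}

theorem IsInvariantForward.isViable {f : E → E} (hinv : IsInvariantForward f D)
    (hcomplete : ∀ x₀ ∈ D, ∃ x : ℝ → E, IsSolution f x ∧ x 0 = x₀) : IsViable f D := fun x₀ hx₀ =>
  let ⟨x, hx, h0⟩ := hcomplete x₀ hx₀
  ⟨x, hx, h0, hinv x hx (h0.symm ▸ hx₀)⟩

theorem IsTrajectoryOn.mem (hF : ∀ i, LocallyLipschitz (F i)) (hD : ∀ i, IsViable (F i) D)
    (hσ : IsCommutationLaw σ) (ha : 0 ≤ a) (hab : a < b) (hx : IsTrajectoryOn F σ a b x)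
    (hxa : x a ∈ D) : ∀ t ∈ Set.Icc a b, x t ∈ D := by
  refine hσ.induction_on_intervals (Q := fun a b => IsTrajectoryOn F σ a b x → x a ∈ D →
    ∀ t ∈ Set.Icc a b, x t ∈ D) ?_ ?_ ha hab hx hxa
  · intro a b c _ hab hbc _ mem_left mem_right hx hxa t ht
    have hxab := mem_left (hx.mono le_rfl hbc.le) hxa
    rcases le_total t b with htb | hbt
    · exact hxab t ⟨ht.1, htb⟩
    · exact mem_right (hx.mono hab.le le_rfl) (hxab b ⟨hab.le, le_rfl⟩) t ⟨hbt, ht.2⟩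
  · intro a b i _ hi hx hxa t ht
    obtain ⟨y, hy, hy0, hyD⟩ := hD i _ hxa
    rw [hx.eqOn_of_const (hF i) hi (hy.isTrajectoryOn hi) (by simp [hy0]) ht]
    exact hyD _ (sub_nonneg.2 ht.1)

theorem IsTrajectory.mem (hF : ∀ i, LocallyLipschitz (F i)) (hD : ∀ i, IsViable (F i) D)
    (hσ : IsCommutationLaw σ) (hx : IsTrajectory F σ x) (hx0 : x 0 ∈ D) {t : ℝ} (ht : 0 ≤ t) :
    x t ∈ D :=
  (hx.isTrajectoryOn le_rfl).mem hF hD hσ le_rfl (ht.trans_lt (lt_add_one t)) hx0 t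
    ⟨ht, (lt_add_one t).le⟩

theorem exists_isTrajectoryOn (hF : ∀ i, LocallyLipschitz (F i)) (hD : ∀ i, IsViable (F i) D)
    (hσ : IsCommutationLaw σ) (ha : 0 ≤ a) (hab : a < b) {x₀ : E} (hx₀ : x₀ ∈ D) :
    ∃ x, IsTrajectoryOn F σ a b x ∧ x a = x₀ := by
  refine hσ.induction_on_intervals (Q := fun a b => ∀ x₀ ∈ D, ∃ x, IsTrajectoryOn F σ a b x ∧
    x a = x₀) ?_ ?_ ha hab x₀ hx₀
  · intro a b c ha hab hbc hb exists_left exists_right x₀ hx₀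
    obtain ⟨x, hx, rfl⟩ := exists_left x₀ hx₀
    obtain ⟨y, hy, hxy⟩ := exists_right (x b) (hx.mem hF hD hσ ha hab hx₀ b ⟨hab.le, le_rfl⟩)
    exact ⟨_, hx.concat hab.le hbc.le hb hy hxy.symm, if_pos hab.le⟩
  · intro a b i _ hi x₀ hx₀
    obtain ⟨y, hy, rfl, -⟩ := hD i x₀ hx₀
    exact ⟨_, hy.isTrajectoryOn hi, by simp⟩

theorem exists_isTrajectory (hF : ∀ i, LocallyLipschitz (F i)) (hD : ∀ i, IsViable (F i) D)
    (hσ : IsCommutationLaw σ) {x₀ : E} (hx₀ : x₀ ∈ D) : ∃ x, IsTrajectory F σ x ∧ x 0 = x₀ := by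
  choose X hX hX0 using fun N : ℕ =>
    exists_isTrajectoryOn hF hD hσ le_rfl (by positivity : (0 : ℝ) < N + 1) hx₀
  have consistent : ∀ N M : ℕ, ∀ t : ℝ, 0 ≤ t → t ≤ N + 1 → t ≤ M + 1 → X N t = X M t := by
    intro N M t h0 hN hM
    rcases h0.eq_or_lt with rfl | ht
    · rw [hX0, hX0]
    · exact ((hX N).mono le_rfl hN).eqOn hF hσ le_rfl ht ((hX M).mono le_rfl hM)
        (by rw [hX0, hX0]) ⟨h0, le_rfl⟩
  have lt_ceil : ∀ t : ℝ, t < ⌈t⌉₊ + 1 := fun t => (Nat.le_ceil t).trans_lt (lt_add_one _)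
  refine ⟨fun t => X ⌈t⌉₊ t, ⟨fun t ht => ?_, fun t ht hσt => ?_⟩, hX0 _⟩
  · have Icc_mem : Set.Icc 0 ((⌈t⌉₊ : ℝ) + 1) ∈ 𝓝[Set.Ici 0] t :=
      inter_mem_nhdsWithin (Set.Ici 0) (Iic_mem_nhds (lt_ceil t))
    refine (((hX ⌈t⌉₊).1 t ⟨ht, (lt_ceil t).le⟩).mono_of_mem_nhdsWithin
      Icc_mem).congr_of_eventuallyEq ?_ rfl
    filter_upwards [Icc_mem] with s hs
    exact consistent _ _ s hs.1 (lt_ceil s).le hs.2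
  · refine ((hX ⌈t⌉₊).2 t ⟨ht, lt_ceil t⟩ hσt).congr_of_eventuallyEq ?_
    filter_upwards [Ioo_mem_nhds ht (lt_ceil t)] with s hs
    exact consistent _ _ s hs.1.le (lt_ceil s).le hs.2.le

theorem IsTrajectory.clm_comp {E' : Type*} [NormedAddCommGroup E'] [NormedSpace ℝ E']
    {G : ι → E' → E'} (L : E →L[ℝ] E') (hL : ∀ i v, G i (L v) = L (F i v))
    (hx : IsTrajectory F σ x) : IsTrajectory G σ fun t => L (x t) := by
  refine ⟨L.continuous.comp_continuousOn hx.1, fun t ht hσt => ?_⟩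
  rw [hL]
  exact L.hasFDerivAt.comp_hasDerivAt t (hx.2 t ht hσt)

theorem IsTrajectory.le_of_fderiv_le {V : E → ℝ} {κ η T : ℝ} (hF : ∀ i, Continuous (F i))
    (hV : Differentiable ℝ V) (hκ : 0 < κ) (hη : 0 ≤ η) (hσ : IsCommutationLaw σ)
    (hx : IsTrajectory F σ x) (hT : 0 ≤ T)
    (h : ∀ i, ∀ t ∈ Set.Ico 0 T, fderiv ℝ V (x t) (F i (x t)) ≤ -κ * V (x t) + κ * η) :
    V (x T) ≤ V (x 0) * Real.exp (-κ * T) + η := by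
  have continuousOn_x : ContinuousOn x (Set.Icc 0 T) := hx.1.mono fun _ ht => ht.1
  have : Nonempty ι := ⟨σ 0⟩
  choose! i hi using fun t (ht : 0 ≤ t) => hσ.exists_eventually_right_eq ht
  have deriv_V : ∀ t ∈ Set.Ico 0 T, HasDerivWithinAt (fun t => V (x t))
      (fderiv ℝ V (x t) (F (i t) (x t))) (Set.Ici t) t := fun t ht =>
    (hV (x t)).hasFDerivAt.comp_hasDerivWithinAt t ((hx.isTrajectoryOn le_rfl).hasDerivWithinAt_Ici
      (hF (i t)) ht.1 ht.2 (hi t ht.1))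
  have gronwall := le_gronwallBound_of_liminf_deriv_right_le (K := -κ) (ε := κ * η)
    (hV.continuous.comp_continuousOn continuousOn_x)
    (fun t ht _ hr => (deriv_V t ht).liminf_right_slope_le hr) le_rfl
    (fun t ht => h (i t) t ht) T ⟨hT, le_rfl⟩
  rw [gronwallBound_of_K_ne_0 (neg_ne_zero.2 hκ.ne'), sub_zero] at gronwall
  calc V (x T) ≤ V (x 0) * Real.exp (-κ * T) + κ * η / -κ * (Real.exp (-κ * T) - 1) := gronwall
    _ = V (x 0) * Real.exp (-κ * T) + (η - η * Real.exp (-κ * T)) := by field_simp; ring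
    _ ≤ V (x 0) * Real.exp (-κ * T) + η := by
        gcongr
        exact sub_le_self _ (by positivity)

theorem isGUAS_of_exponential_decay {B : E → ℝ} {κ : ℝ} (hF : ∀ i, F i 0 = 0) (hD : D ∈ 𝓝 0)
    (hcomplete : ∀ σ : ℝ → ι, IsCommutationLaw σ → ∀ x₀ ∈ D, ∃ x, IsTrajectory F σ x ∧ x 0 = x₀)
    (hB : Tendsto B (𝓝 0) (𝓝 0)) (hκ : 0 < κ)
    (hdecay : ∀ (σ : ℝ → ι) (x : ℝ → E), IsCommutationLaw σ → IsTrajectory F σ x → x 0 ∈ D →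
      ∀ t, 0 ≤ t → ‖x t‖ ^ 2 ≤ B (x 0) * Real.exp (-κ * t)) :
    IsGUAS F 0 D := by
  have attractive : ∀ (σ : ℝ → ι) (x : ℝ → E), IsCommutationLaw σ → IsTrajectory F σ x →
      x 0 ∈ D → Tendsto x atTop (𝓝 0) := fun σ x hσ hx hx0 =>
    tendsto_zero_of_norm_sq_le_exp hκ (hdecay σ x hσ hx hx0)
  refine ⟨hF, hcomplete, fun e he => ?_, attractive⟩
  obtain ⟨δ, hδ, hball⟩ := Metric.nhds_basis_closedBall.eventually_iff.1
    ((hB.eventually_lt_const (pow_pos he 2)).and hD)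
  simp only [mem_closedBall_zero_iff] at hball
  simp only [sub_zero]
  refine ⟨δ, hδ, fun σ x hσ hx hx0 t ht => ?_, fun σ x hσ hx hx0 =>
    attractive σ x hσ hx (hball hx0).2⟩
  obtain ⟨hBx, hxD⟩ := hball hx0
  refine le_of_sq_le_sq ?_ he.le
  calc ‖x t‖ ^ 2 ≤ B (x 0) * Real.exp (-κ * t) := hdecay σ x hσ hx hxD t ht.le
    _ ≤ e ^ 2 * Real.exp (-κ * t) := by gcongr
    _ ≤ e ^ 2 := mul_le_of_le_one_right (sq_nonneg e)
        (Real.exp_le_one_iff.2 (mul_nonpos_of_nonpos_of_nonneg (neg_nonpos.2 hκ.le) ht.le))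

end SwitchedSystems

section SimultaneousTriangularization

open Module

theorem exists_basis_castSucc_eq_coe_of_ker {K V : Type*} [Field K] [AddCommGroup V] [Module K V]
    {φ : Dual K V} (hφ : φ ≠ 0) {d : ℕ} (b : Basis (Fin d) K (LinearMap.ker φ)) :
    ∃ B : Basis (Fin (d + 1)) K V, ∀ q, B (Fin.castSucc q) = b q := by
  obtain ⟨y, hy⟩ := DFunLike.ne_iff.1 hφ
  rw [LinearMap.zero_apply] at hy
  refine ⟨Basis.mkFinSnoc b y (fun c v hv hcv => ?_) fun z => ⟨-(φ z / φ y), by simp [hy]⟩,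
    fun q => by simp⟩
  have hφcv := congrArg φ hcv
  rw [map_add, LinearMap.mem_ker.1 hv, map_smul, add_zero, map_zero] at hφcv
  exact (smul_eq_zero.1 hφcv).resolve_right hy

theorem repr_coe_eq_snoc {R M : Type*} [Ring R] [AddCommGroup M] [Module R M] {N : Submodule R M}
    {d : ℕ} {b : Basis (Fin d) R N} {B : Basis (Fin (d + 1)) R M}
    (hB : ∀ q, B (Fin.castSucc q) = b q) (v : N) :
    ⇑(B.repr v) = Fin.snoc (α := fun _ => R) (b.repr v) 0 := by
  have sum_eq : (v : M) = ∑ l, Fin.snoc (α := fun _ => R) (b.repr v) 0 l • B l := by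
    simp only [Fin.sum_univ_castSucc, Fin.snoc_castSucc, Fin.snoc_last, zero_smul, add_zero, hB]
    conv_lhs => rw [← b.sum_repr v]
    push_cast
    rfl
  conv_lhs => rw [sum_eq]
  exact B.repr_sum_self _

variable {k L : Type*} [Field k] [CharZero k] [IsAlgClosed k] [LieRing L] [LieAlgebra k L]
  [LieAlgebra.IsSolvable L]

/-- An invariant hyperplane is the kernel of a common eigenvector of the dual module. -/
theorem exists_dual_ne_zero_lie_mem_ker (V : Type*) [AddCommGroup V] [Module k V]
    [FiniteDimensional k V] [Nontrivial V] [LieRingModule L V] [LieModule k L V] :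
    ∃ φ : Dual k V, φ ≠ 0 ∧ ∀ (x : L) (v : V), φ v = 0 → φ ⁅x, v⁆ = 0 := by
  obtain ⟨χ, hχ⟩ := LieModule.exists_nontrivial_weightSpace_of_isSolvable k L (V →ₗ[k] k)
  obtain ⟨⟨φ, hφ⟩, hφ0⟩ := exists_ne (0 : LieModule.weightSpace (V →ₗ[k] k) χ)
  rw [LieModule.mem_weightSpace] at hφ
  refine ⟨φ, fun h => hφ0 (Subtype.ext h), fun x v hv => ?_⟩
  have lie_apply := LinearMap.congr_fun (hφ x) v
  rwa [Dual.lie_apply, LinearMap.smul_apply, hv, smul_zero, neg_eq_zero] at lie_apply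

theorem exists_basis_isUpperTriangular_toEnd {d : ℕ} {V : Type*} [AddCommGroup V] [Module k V]
    [FiniteDimensional k V] [LieRingModule L V] [LieModule k L V] (hd : finrank k V = d) :
    ∃ b : Basis (Fin d) k V,
      ∀ x : L, (LinearMap.toMatrix b b (LieModule.toEnd k L V x)).IsUpperTriangular := by
  induction d generalizing V with
  | zero => exact ⟨finBasisOfFinrankEq k V hd, fun x l => l.elim0⟩
  | succ d ih =>
    have : Nontrivial V := nontrivial_of_finrank_pos (R := k) (by omega)
    obtain ⟨φ, hφ, lie_mem_ker⟩ := exists_dual_ne_zero_lie_mem_ker (k := k) (L := L) V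
    let kerφ : LieSubmodule k L V := { LinearMap.ker φ with lie_mem := lie_mem_ker _ _ }
    obtain ⟨b, hb⟩ := ih (V := kerφ)
      (Nat.succ_injective ((Dual.finrank_ker_add_one_of_ne_zero hφ).trans hd))
    obtain ⟨B, hB⟩ := exists_basis_castSucc_eq_coe_of_ker hφ b
    refine ⟨B, fun x l q hql => ?_⟩
    cases q using Fin.lastCases with
    | last => exact absurd hql (not_lt.2 (Fin.le_last l))
    | cast q =>
      have repr_lie := congrFun (repr_coe_eq_snoc (N := kerφ.toSubmodule) hB (⁅x, b q⁆ : kerφ)) l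
      rw [LinearMap.toMatrix_apply, LieModule.toEnd_apply_apply, hB]
      refine repr_lie.trans ?_
      cases l using Fin.lastCases with
      | last => exact Fin.snoc_last ..
      | cast l =>
        rw [Fin.snoc_castSucc]
        simpa [LinearMap.toMatrix_apply] using hb x (Fin.castSucc_lt_castSucc_iff.1 hql)

attribute [local instance] LieRing.ofAssociativeRing

theorem GeneratesSolvable.exists_isUpperTriangular_conj {n : ℕ} {ι : Type*}
    {A : ι → Matrix (Fin n) (Fin n) ℂ} (hA : GeneratesSolvable A) :
    ∃ P : Matrix (Fin n) (Fin n) ℂ, IsUnit P.det ∧ ∀ i, (P⁻¹ * A i * P).IsUpperTriangular := by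
  have : LieAlgebra.IsSolvable
    (LieSubalgebra.lieSpan ℂ (Matrix (Fin n) (Fin n) ℂ) (Set.range A)) := hA
  obtain ⟨b, hb⟩ := exists_basis_isUpperTriangular_toEnd (k := ℂ)
    (L := LieSubalgebra.lieSpan ℂ (Matrix (Fin n) (Fin n) ℂ) (Set.range A))
    (V := Fin n → ℂ) (d := n) (by simp)
  let e := Pi.basisFun ℂ (Fin n)
  have left_inv : b.toMatrix e * e.toMatrix b = 1 := b.toMatrix_mul_toMatrix_flip e
  refine ⟨e.toMatrix b, Matrix.isUnit_det_of_left_inverse left_inv, fun i => ?_⟩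
  have toMatrix_toLin' : LinearMap.toMatrix e e (Matrix.toLin' (A i)) = A i :=
    LinearMap.toMatrix'_toLin' _
  rw [Matrix.inv_eq_left_inv left_inv, ← toMatrix_toLin',
    basis_toMatrix_mul_linearMap_toMatrix_mul_basis_toMatrix]
  exact hb ⟨A i, LieSubalgebra.subset_lieSpan ⟨i, rfl⟩⟩

end SimultaneousTriangularization

section Normalization

variable {n : ℕ}

attribute [local instance] Matrix.linftyOpNormedAddCommGroup Matrix.linftyOpNormedSpace

theorem matrixSupNorm_smul (c : ℂ) (A : Matrix (Fin n) (Fin n) ℂ) :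
    matrixSupNorm (c • A) = ‖c‖ * matrixSupNorm A :=
  norm_smul c A

theorem matrixSupNorm_pos {A : Matrix (Fin n) (Fin n) ℂ} (hA : A ≠ 0) : 0 < matrixSupNorm A :=
  norm_pos_iff.2 hA

theorem norm_mulVec_le_matrixSupNorm_mul_norm (A : Matrix (Fin n) (Fin n) ℂ) (v : Fin n → ℂ) :
    ‖A.mulVec v‖ ≤ matrixSupNorm A * ‖v‖ :=
  Matrix.linfty_opNorm_mulVec A v

theorem exists_isTriangularizer [NeZero n] {ι : Type*} {A : ι → Matrix (Fin n) (Fin n) ℂ}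
    (hA : GeneratesSolvable A) : ∃ P, IsTriangularizer A P := by
  obtain ⟨P, hP, upper⟩ := hA.exists_isUpperTriangular_conj
  have inv_ne_zero : P⁻¹ ≠ 0 := (Matrix.isUnit_nonsing_inv_iff.2
    ((Matrix.isUnit_iff_isUnit_det P).2 hP)).ne_zero
  have norm_pos := matrixSupNorm_pos inv_ne_zero
  let s : ℂˣ := Units.mk0 (matrixSupNorm P⁻¹ : ℂ) (Complex.ofReal_ne_zero.2 norm_pos.ne')
  have inv_smul : (s • P)⁻¹ = s⁻¹ • P⁻¹ := Matrix.inv_smul' P s hP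
  refine ⟨s • P, ?_, ?_, fun i l q hql => ?_⟩
  · rw [Units.smul_def, Matrix.det_smul]
    exact (s.isUnit.pow _).mul hP
  · rw [inv_smul, Units.smul_def, matrixSupNorm_smul]
    simp [s, abs_of_pos norm_pos, norm_pos.ne']
  · rw [inv_smul, Matrix.smul_mul, Matrix.smul_mul, Matrix.mul_smul, inv_smul_smul]
    exact upper i hql

end Normalization

section Decay

variable {n : ℕ} {ι : Type*}

theorem polydisk_eq_ball {ρ : ℝ} (hρ : 0 < ρ) : polydisk n ρ = Metric.ball 0 ρ := by
  ext z
  rw [mem_ball_zero_iff, pi_norm_lt_iff hρ]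
  rfl

theorem locallyLipschitz_polyField (F : Fin n → MvPolynomial (Fin n) ℂ) :
    LocallyLipschitz (polyField F) := by
  have : ContDiff ℂ 1 (polyField F) := by
    refine contDiff_pi.2 fun l => ?_
    simp only [polyField, MvPolynomial.eval_eq']
    fun_prop
  exact this.locallyLipschitz

theorem exists_isTriangularStable_changeCoords [Finite ι] {F : ι → Fin n → MvPolynomial (Fin n) ℂ}
    (hyp : ∀ i, IsHyperbolicStableZero (F i)) {P : Matrix (Fin n) (Fin n) ℂ}
    (hP : IsTriangularizer (fun i => jacobianZero (F i)) P) :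
    ∃ c, 0 < c ∧ ∀ i, IsTriangularStable c (changeCoords P (F i)) := by
  have upper : ∀ i, (jacobianZero (changeCoords P (F i))).IsUpperTriangular := fun i l q hql => by
    rw [jacobianZero_changeCoords]
    exact hP.upper i l q hql
  have diag_neg : ∀ i l, (jacobianZero (changeCoords P (F i)) l l).re < 0 := fun i l => by
    rw [jacobianZero_changeCoords]
    exact (hyp i).2 _ (hasEigenvalue_toLin'_of_isUpperTriangular_conj hP.isUnit_det (hP.upper i) l)
  have diag_le : ∀ᶠ c : ℝ in 𝓝[>] 0, ∀ i l, (jacobianZero (changeCoords P (F i)) l l).re ≤ -c :=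
    eventually_all.2 fun i => eventually_all.2 fun l => nhdsWithin_le_nhds
      ((eventually_le_nhds (neg_pos.2 (diag_neg i l))).mono fun c hc => le_neg.1 hc)
  obtain ⟨c, hc, hc0⟩ := (diag_le.and self_mem_nhdsWithin).exists
  refine ⟨c, hc0, fun i => ⟨?_, upper i, hc i⟩⟩
  rw [polyField_changeCoords, Matrix.mulVec_zero, (hyp i).1, Matrix.mulVec_zero]

theorem exists_le_of_iSup_limsup_lt_one [Finite ι] {ρ : ι → ℕ → ℕ → ℝ}
    (h : (⨆ i, limsup (fun j : ℕ => ⨆ k ∈ Finset.Ico 1 j, ENNReal.ofReal (ρ i j k)) atTop) < 1) :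
    ∃ q, 0 < q ∧ q < 1 ∧ ∃ J, ∀ i j k, J ≤ j → 1 ≤ k → k < j → ρ i j k ≤ q := by
  obtain ⟨Q, hQ, hQ1⟩ := exists_between h
  lift Q to NNReal using (hQ1.trans ENNReal.one_lt_top).ne
  have eventually_lt : ∀ᶠ j in atTop, ∀ i, ⨆ k ∈ Finset.Ico 1 j, ENNReal.ofReal (ρ i j k) < Q :=
    eventually_all.2 fun i => eventually_lt_of_limsup_lt ((le_iSup _ i).trans_lt hQ)
  obtain ⟨J, hJ⟩ := eventually_atTop.1 eventually_lt
  refine ⟨Q, by exact_mod_cast zero_le.trans_lt hQ, by exact_mod_cast hQ1, J,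
    fun i j k hj hk hkj => ?_⟩
  rw [← Real.toNNReal_le_iff_le_coe, ← ENNReal.coe_le_coe]
  exact (le_iSup₂ (f := fun k (_ : k ∈ Finset.Ico 1 j) => ENNReal.ofReal (ρ i j k)) k
    (Finset.mem_Ico.2 ⟨hk, hkj⟩)).trans (hJ j hj i).le

theorem IsTrajectory.norm_sq_le_of_isTriangularStable [NeZero n] [Finite ι] {c q E T : ℝ}
    {F : ι → Fin n → MvPolynomial (Fin n) ℂ} (hF : ∀ i, IsTriangularStable c (F i)) (hc : 0 < c)
    (hq0 : 0 ≤ q) (hq1 : q < 1) {ε : ℕ → ℝ} (hε : ∀ k, 1 ≤ ε k) (hεE : ∀ k, ε k ≤ E)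
    (hcpl : ∀ i j k, 1 ≤ k → k < j → ε k * couplingRatio (F i) j k ≤ q * ε j)
    {σ : ℝ → ι} {z : ℝ → Fin n → ℂ} (hσ : IsCommutationLaw σ)
    (hz : IsTrajectory (fun i => polyField (F i)) σ z) (hz1 : ∀ t, 0 ≤ t → ‖z t‖ < 1)
    (hT : 0 ≤ T) :
    ‖z T‖ ^ 2 ≤ E * (((1 - ‖z 0‖ ^ 2)⁻¹) ^ n - 1) * Real.exp (-(2 * (1 - √q) * c) * T) := by
  have hε0 : ∀ k, 0 ≤ ε k := fun k => zero_le_one.trans (hε k)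
  have one_sub_sqrt_pos : 0 < 1 - √q := sub_pos.2 (by simpa using Real.sqrt_lt_sqrt hq0 hq1)
  set κ := 2 * (1 - √q) * c
  have hκ : 0 < κ := by positivity
  obtain ⟨t₁, ht₁, isMaxOn_norm⟩ := isCompact_Icc.exists_isMaxOn (Set.nonempty_Icc.2 hT)
    (hz.1.mono fun t ht => ht.1 : ContinuousOn z (Set.Icc 0 T)).norm
  refine le_of_forall_pos_le_add fun η hη => ?_
  obtain ⟨N, hfderiv, hnorm⟩ := ((eventually_all.2 fun i =>
    (hF i).eventually_fderiv_lyapunovSum_le hc hq0 hq1.le hε0 hεE (hcpl i) (norm_nonneg (z t₁))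
      (hz1 t₁ ht₁.1) (mul_pos hκ hη)).and (eventually_norm_sq_le_lyapunovSum (n := n) hε)).exists
  calc ‖z T‖ ^ 2 ≤ lyapunovSum ε N (z T) := hnorm _
    _ ≤ lyapunovSum ε N (z 0) * Real.exp (-κ * T) + η :=
        hz.le_of_fderiv_le (fun i => (locallyLipschitz_polyField (F i)).continuous)
          (fun z => (hasFDerivAt_lyapunovSum ε N z).differentiableAt) hκ hη.le hσ hT
          fun i t ht => hfderiv i _ (isMaxOn_norm (Set.Ico_subset_Icc_self ht))
    _ ≤ E * (((1 - ‖z 0‖ ^ 2)⁻¹) ^ n - 1) * Real.exp (-κ * T) + η := by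
        gcongr
        exact lyapunovSum_le hε0 hεE (hz1 0 le_rfl) N

variable {F : ι → Fin n → MvPolynomial (Fin n) ℂ} {P : Matrix (Fin n) (Fin n) ℂ}
  {σ : ℝ → ι} {x : ℝ → Fin n → ℂ}

theorem IsTrajectory.inv_mulVec (hP : IsUnit P.det)
    (hx : IsTrajectory (fun i => polyField (F i)) σ x) :
    IsTrajectory (fun i => polyField (changeCoords P (F i))) σ fun t => P⁻¹.mulVec (x t) :=
  hx.clm_comp ((LinearMap.toContinuousLinearMap P⁻¹.mulVecLin).restrictScalars ℝ) fun i v => by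
    simp [polyField_changeCoords, Matrix.mulVec_mulVec, Matrix.mul_nonsing_inv P hP]

theorem IsTriangularizer.norm_inv_mulVec_le {A : ι → Matrix (Fin n) (Fin n) ℂ}
    (hP : IsTriangularizer A P) (v : Fin n → ℂ) : ‖P⁻¹.mulVec v‖ ≤ ‖v‖ := by
  simpa [hP.norm_inv] using norm_mulVec_le_matrixSupNorm_mul_norm P⁻¹ v

theorem norm_le_matrixSupNorm_mul_norm_inv_mulVec (hP : IsUnit P.det) (v : Fin n → ℂ) :
    ‖v‖ ≤ matrixSupNorm P * ‖P⁻¹.mulVec v‖ := by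
  simpa [Matrix.mulVec_mulVec, Matrix.mul_nonsing_inv P hP] using
    norm_mulVec_le_matrixSupNorm_mul_norm P (P⁻¹.mulVec v)

theorem tendsto_inv_one_sub_norm_sq_pow_sub_one {E : Type*} [NormedAddCommGroup E] (n : ℕ) :
    Tendsto (fun v : E => ((1 - ‖v‖ ^ 2)⁻¹) ^ n - 1) (𝓝 0) (𝓝 0) := by
  have ne_zero : 1 - ‖(0 : E)‖ ^ 2 ≠ 0 := by simp
  have continuousAt_zero : ContinuousAt (fun v : E => ((1 - ‖v‖ ^ 2)⁻¹) ^ n - 1) 0 := by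
    fun_prop (disch := exact ne_zero)
  simpa [ContinuousAt] using continuousAt_zero

theorem exists_exponential_decay [Finite ι] [NeZero n] (hyp : ∀ i, IsHyperbolicStableZero (F i))
    (hviable : ∀ i, IsViable (polyField (F i)) (polydisk n 1))
    (hP : IsTriangularizer (fun i => jacobianZero (F i)) P)
    (h : (⨆ i, limsup (fun j : ℕ => ⨆ k ∈ Finset.Ico 1 j,
      ENNReal.ofReal (couplingRatio (changeCoords P (F i)) j k)) atTop) < 1) :
    ∃ (B : (Fin n → ℂ) → ℝ) (κ : ℝ), Tendsto B (𝓝 0) (𝓝 0) ∧ 0 < κ ∧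
      ∀ (σ : ℝ → ι) (x : ℝ → Fin n → ℂ), IsCommutationLaw σ →
        IsTrajectory (fun i => polyField (F i)) σ x → x 0 ∈ polydisk n 1 → ∀ t, 0 ≤ t →
          ‖x t‖ ^ 2 ≤ B (x 0) * Real.exp (-κ * t) := by
  obtain ⟨c, hc, hstable⟩ := exists_isTriangularStable_changeCoords hyp hP
  obtain ⟨q, hq0, hq1, J, hJ⟩ := exists_le_of_iSup_limsup_lt_one h
  obtain ⟨ε, E, hε, hεE, hcpl⟩ := exists_bounded_weights
    (fun i => couplingRatio (changeCoords P (F i))) hq0 hJ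
  let B₀ : (Fin n → ℂ) → ℝ := fun v => E * (((1 - ‖v‖ ^ 2)⁻¹) ^ n - 1)
  have tendsto_B₀ : Tendsto B₀ (𝓝 0) (𝓝 0) := by
    simpa only [mul_zero] using (tendsto_inv_one_sub_norm_sq_pow_sub_one n).const_mul E
  have tendsto_inv_mulVec : Tendsto P⁻¹.mulVec (𝓝 0) (𝓝 0) := by
    simpa [ContinuousAt] using (by fun_prop : ContinuousAt P⁻¹.mulVec 0)
  refine ⟨fun v => matrixSupNorm P ^ 2 * B₀ (P⁻¹.mulVec v), 2 * (1 - √q) * c,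
    by simpa using (tendsto_B₀.comp tendsto_inv_mulVec).const_mul (matrixSupNorm P ^ 2),
    mul_pos (mul_pos two_pos (sub_pos.2 (by simpa using Real.sqrt_lt_sqrt hq0.le hq1))) hc,
    fun σ x hσ hx hx0 t ht => ?_⟩
  have norm_lt_one : ∀ t, 0 ≤ t → ‖P⁻¹.mulVec (x t)‖ < 1 := fun t ht => by
    have mem := hx.mem (fun i => locallyLipschitz_polyField (F i)) hviable hσ hx0 ht
    rw [polydisk_eq_ball one_pos, mem_ball_zero_iff] at mem
    exact (hP.norm_inv_mulVec_le _).trans_lt mem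
  have decay := (hx.inv_mulVec hP.isUnit_det).norm_sq_le_of_isTriangularStable hstable hc
    hq0.le hq1 hε hεE hcpl hσ norm_lt_one ht
  calc ‖x t‖ ^ 2 ≤ (matrixSupNorm P * ‖P⁻¹.mulVec (x t)‖) ^ 2 := by
        gcongr
        exact norm_le_matrixSupNorm_mul_norm_inv_mulVec hP.isUnit_det _
    _ = matrixSupNorm P ^ 2 * ‖P⁻¹.mulVec (x t)‖ ^ 2 := mul_pow _ _ _
    _ ≤ matrixSupNorm P ^ 2 * (B₀ (P⁻¹.mulVec (x 0)) * Real.exp (-(2 * (1 - √q) * c) * t)) := by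
        gcongr
    _ = _ := (mul_assoc _ _ _).symm

end Decay

theorem mainTheorem2_general {n : ℕ} [NeZero n] {ι : Type*} [Finite ι]
    (F : ι → Fin n → MvPolynomial (Fin n) ℂ) (hyp : ∀ i, IsHyperbolicStableZero (F i))
    (hviable : ∀ i, IsViable (polyField (F i)) (polydisk n 1))
    (hsolv : GeneratesSolvable fun i => jacobianZero (F i)) :
    (∃ P : Matrix (Fin n) (Fin n) ℂ, IsTriangularizer (fun i => jacobianZero (F i)) P) ∧
    ∀ P : Matrix (Fin n) (Fin n) ℂ, IsTriangularizer (fun i => jacobianZero (F i)) P →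
      (⨆ i, limsup (fun j : ℕ => ⨆ k ∈ Finset.Ico 1 j,
        ENNReal.ofReal (couplingRatio (changeCoords P (F i)) j k)) atTop) < 1 →
      IsGUAS (fun i => polyField (F i)) 0 (polydisk n 1) := by
  refine ⟨exists_isTriangularizer hsolv, fun P hP h => ?_⟩
  obtain ⟨B, κ, hB, hκ, hdecay⟩ := exists_exponential_decay hyp hviable hP h
  have polydisk_mem_nhds : polydisk n 1 ∈ 𝓝 0 := by
    rw [polydisk_eq_ball one_pos]
    exact Metric.ball_mem_nhds 0 one_pos
  exact isGUAS_of_exponential_decay (fun i => (hyp i).1) polydisk_mem_nhds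
    (fun σ hσ x₀ => exists_isTrajectory (fun i => locallyLipschitz_polyField (F i)) hviable hσ)
    hB hκ hdecay

end

theorem mainTheorem2 {n m : ℕ} [NeZero n] (F : Fin m → Fin n → MvPolynomial (Fin n) ℂ)
    (hyp : ∀ i, IsHyperbolicStableZero (F i))
    (hGAS : ∀ i, IsGloballyAsymptoticallyStable (polyField (F i)) 0 (polydisk n 1))
    (hsolv : GeneratesSolvable fun i => jacobianZero (F i))
    (hinv : ∀ i, IsInvariantForward (polyField (F i)) (polydisk n 1)) :
    (∃ P : Matrix (Fin n) (Fin n) ℂ, IsTriangularizer (fun i => jacobianZero (F i)) P) ∧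
    ∀ P : Matrix (Fin n) (Fin n) ℂ, IsTriangularizer (fun i => jacobianZero (F i)) P →
      (⨆ i : Fin m, limsup (fun j : ℕ => ⨆ k ∈ Finset.Ico 1 j,
        ENNReal.ofReal (couplingRatio (changeCoords P (F i)) j k)) atTop) < 1 →
      IsGUAS (fun i => polyField (F i)) 0 (polydisk n 1) :=
  mainTheorem2_general F hyp (fun i => (hinv i).isViable (hGAS i).complete) hsolv
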